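/- Let $d$ and $t$ be integers with $1\le t\le d-2$, and let $P\subset\mathbb R^d$ be a $d$-dimensional convex polytope that contains the origin in its interior. Suppose that every $t$-dimensional face $F$ of $P$ is tangent to the unit sphere $S^{d-1}$, that is, there is a point $x\in F\cap S^{d-1}$ such that $F$ is contained in the tangent hyperplane $\{y:\langle x,y\rangle=1\}$ of $S^{d-1}$ at $x$. Let $P^*=\{y\in\mathbb R^d:\langle x,y\rangle\le 1\text{ for all }x\in P\}$ be the polar of $P$, and for a face $F$ of $P$ let $F^\circ=\{y\in P^*:\langle x,y\rangle=1\text{ for all }x\in F\}$ be the dual face of $P^*$. Put $Q=\operatorname{conv}(P\cup P^*)$. For a finite graded poset $L$ with minimum $\hat 0$ and maximum $\hat 1$, whose rank function satisfies $r(\hat 0)=0$, let $L_t$ be the set of elements of rank $t+1$, and let $E_t(L)$ be the poset, ordered by reversed inclusion, that consists of the following subsets of $L$: the empty set, the sets $\{y\}$ with $y\in L_t$, and the intervals $[x,z]$ such that $x<y<z$ for some $y\in L_t$. Write $E_t(P)$ for $E_t$ of the face lattice of $P$ (all faces of $P$, including $\emptyset$ and $P$, ordered by inclusion). Then $Q$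 is a $d$-polytope whose face lattice is isomorphic to $E_t(P)$. Moreover, $F\mapsto\operatorname{conv}(F\cup F^\circ)$ is a bijection from the set of $t$-faces of $P$ onto the set of facets ($(d-1)$-faces) of $Q$, and each $\operatorname{conv}(F\cup F^\circ)$ is an orthogonal sum of $F$ and $F^\circ$: the affine hulls of $F$ and $F^\circ$ are orthogonal and meet in a point that lies in the relative interior of both $F$ and $F^\circ$. -/

import Mathlib

/-- A (convex) polytope: the convex hull of finitely many points. -/
def IsConvexPolytope {d : ℕ} (P : Set (EuclideanSpace ℝ (Fin d))) : Prop :=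
  ∃ s : Set (EuclideanSpace ℝ (Fin d)), s.Finite ∧ P = convexHull ℝ s

/-- The set `A` is nonempty and its affine hull has dimension `k`. -/
def HasAffineDim {d : ℕ} (A : Set (EuclideanSpace ℝ (Fin d))) (k : ℕ) : Prop :=
  A.Nonempty ∧ Module.finrank ℝ (vectorSpan ℝ A) = k

/-- A `k`-polytope: a polytope of dimension `k`. -/
def IsPolytopeOfDim {d : ℕ} (k : ℕ) (P : Set (EuclideanSpace ℝ (Fin d))) : Prop :=
  IsConvexPolytope P ∧ HasAffineDim P k

/-- The face lattice of `P`, ordered by inclusion. The faces of a polytope are its exposed subsets: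
the sets where a linear functional attains its maximum over `P` (this includes `P` itself, through
the zero functional), together with the empty face. -/
abbrev FaceLattice {d : ℕ} (P : Set (EuclideanSpace ℝ (Fin d))) : Type :=
  {F : Set (EuclideanSpace ℝ (Fin d)) // IsExposed ℝ P F}

/-- The set of all `k`-dimensional faces of `P`. -/
def facesOfDim {d : ℕ} (P : Set (EuclideanSpace ℝ (Fin d))) (k : ℕ) :
    Set (Set (EuclideanSpace ℝ (Fin d))) :=
  {F | IsExposed ℝ P F ∧ HasAffineDim F k}

/-- `F` is tangent to the unit sphere in some point `x` of `F`: the point `x` lies on the sphere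
and `F` is contained in the tangent hyperplane `{y | ⟪x, y⟫ = 1}` of the sphere at `x`. -/
def IsTangentToUnitSphere {d : ℕ} (F : Set (EuclideanSpace ℝ (Fin d))) : Prop :=
  ∃ x ∈ F, x ∈ Metric.sphere (0 : EuclideanSpace ℝ (Fin d)) 1 ∧ ∀ y ∈ F, inner ℝ x y = 1

/-- The polar `P* = {y | ⟪x, y⟫ ≤ 1 for all x ∈ P}`. -/
def polarBody {d : ℕ} (P : Set (EuclideanSpace ℝ (Fin d))) : Set (EuclideanSpace ℝ (Fin d)) :=
  {y | ∀ x ∈ P, inner ℝ x y ≤ 1}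

/-- The face `F° = {y ∈ P* | ⟪x, y⟫ = 1 for all x ∈ F}` of the polar `P*` dual to the face `F`. -/
def dualFace {d : ℕ} (P F : Set (EuclideanSpace ℝ (Fin d))) : Set (EuclideanSpace ℝ (Fin d)) :=
  {y | y ∈ polarBody P ∧ ∀ x ∈ F, inner ℝ x y = 1}

/-- `G` is the orthogonal sum of `A` and `B`: the convex hull of `A ∪ B`, where the affine hulls of
`A` and `B` are orthogonal and meet in a point that is relatively interior to both. -/
def IsOrthogonalSum {d : ℕ} (G A B : Set (EuclideanSpace ℝ (Fin d))) : Prop :=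
  G = convexHull ℝ (A ∪ B) ∧
    ∃ x, x ∈ intrinsicInterior ℝ A ∧ x ∈ intrinsicInterior ℝ B ∧
      ∀ a ∈ A, ∀ b ∈ B, inner ℝ (a - x) (b - x) = 0

/-- `L_t`: the elements of rank `t + 1` (dimension `t`) of a graded poset with minimum. The rank of
an element is its height, the maximal length of a chain ending in it. -/
def rankLevel (L : Type*) [PartialOrder L] (t : ℕ) : Set L :=
  {y | Order.height y = ((t + 1 : ℕ) : ℕ∞)}

/-- The subsets of `L` that form `E_t(L)`: the empty set, the singletons `{y}` with `y ∈ L_t`, and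
the intervals `[x, z]` such that `x < y < z` for some `y ∈ L_t`. -/
def etSets (L : Type*) [PartialOrder L] (t : ℕ) : Set (Set L) :=
  {s | s = ∅ ∨ (∃ y ∈ rankLevel L t, s = {y}) ∨
    ∃ x z : L, (∃ y ∈ rankLevel L t, x < y ∧ y < z) ∧ s = Set.Icc x z}

/-- The poset `E_t(L)`: the sets above, ordered by reversed inclusion. -/
abbrev EtConstruction (L : Type*) [PartialOrder L] (t : ℕ) : Type _ :=
  (etSets L t)ᵒᵈ

/-! Write `R` for the polar of `P`. The polar of `Q = conv (P ∪ R)` is `P ∩ R`, so the facets of `Q`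
are governed by the extreme points of `P ∩ R`. The key claim is that these are tangent points of
`t`-faces (`exists_tangentAt_of_mem_extremePoints`). Every `c ∈ P ∩ R` has `⟪c, c⟫ ≤ 1`. If `c` is
extreme, the smallest faces of `P` and of `R` through `c` have directions meeting only in `0`, so
the first has dimension at most `t` or the second at most `d - 1 - t`. Hence `c` lies in some
`t`-face `F` or in some `F°`. Either way `⟪x, c⟫ = 1` for the tangent point `x` of `F`, and equality
in Cauchy-Schwarz gives `c = x`.

Conversely, the tangent hyperplane at the tangent point `x` of `F` supports `P` exactly along `F`
and `R` exactly along `F°`. For `P`: each face larger than `F` contains a `t`-face missing `x`,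
whose tangent point is strictly below the hyperplane, and such a drop on every larger face gives
strictness off `F` (`inner_lt_of_forall_face`). For `R`: were `x` in a proper face of `F`, it would
lie in another `t`-face, which would then share its tangent point and hence contain `F`. So `conv (F
∪ F°)` is the face of `Q` dual to the single point `x`, that is, a facet.

For the lattice, a face `G` of `Q` is sent to the set of faces `H` of `P` with `G ∩ P ⊆ H` and `G ∩
R ⊆ H°`. This is an interval for general `G`, a singleton for facets and empty for `Q`. It
determines `G`, since faces are intersections of facets. Every interval occurs, since its two ends
are recovered from the `t`-faces between them (`exists_face_of_rank_not_mem`, used in `P` and in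
`R`). -/

open scoped RealInnerProductSpace

/-! ### Finite convex hulls, linear inequalities and extreme points -/

/-- A point of the convex hull of `V` at which all functionals of `S`, bounded by `1` on `V`, take
the value `1` lies in the convex hull of the points of `V` with the same property. -/
theorem mem_convexHull_filter_of_inner_eq_one {E : Type*} [NormedAddCommGroup E]
    [InnerProductSpace ℝ E] {V : Finset E} {S : Set E} (hS : ∀ s ∈ S, ∀ v ∈ V, ⟪s, v⟫ ≤ 1) {x : E}
    (hx : x ∈ convexHull ℝ (V : Set E)) (hx1 : ∀ s ∈ S, ⟪s, x⟫ = 1) :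
    x ∈ convexHull ℝ {v | v ∈ V ∧ ∀ s ∈ S, ⟪s, v⟫ = 1} := by
  classical
  obtain ⟨w, hw0, hw1, hwx⟩ := Finset.mem_convexHull'.1 hx
  have key : ∀ v ∈ V, w v ≠ 0 → ∀ s ∈ S, ⟪s, v⟫ = 1 := by
    intro v hv hwv s hs
    have h1 : ∑ v ∈ V, w v * (1 - ⟪s, v⟫) = 0 := by
      have : ⟪s, x⟫ = ∑ v ∈ V, w v * ⟪s, v⟫ := by
        rw [← hwx, inner_sum]; simp [inner_smul_right]
      simp only [mul_sub, mul_one, Finset.sum_sub_distrib, hw1, ← this, hx1 s hs, sub_self]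
    have h2 := (Finset.sum_eq_zero_iff_of_nonneg fun v hv =>
      mul_nonneg (hw0 v hv) (sub_nonneg.2 (hS s hs v hv))).1 h1 v hv
    have := (mul_eq_zero.1 h2).resolve_left hwv
    linarith
  have : x ∈ convexHull ℝ ((V.filter fun v => w v ≠ 0 : Finset E) : Set E) := by
    refine Finset.mem_convexHull'.2 ⟨w, fun v hv => hw0 v (Finset.mem_filter.1 hv).1, ?_, ?_⟩
    · rw [Finset.sum_filter_ne_zero, hw1]
    · rw [← hwx, Finset.sum_filter]
      refine Finset.sum_congr rfl fun v _ => ?_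
      by_cases h : w v = 0 <;> simp [h]
  refine convexHull_mono ?_ this
  intro v hv
  have := Finset.mem_filter.1 (Finset.mem_coe.1 hv)
  exact ⟨this.1, key v this.1 this.2⟩

/-- A functional bounded by `c` on `V` is bounded by `c` on the convex hull of `V`. -/
theorem inner_le_of_mem_convexHull {E : Type*} [NormedAddCommGroup E] [InnerProductSpace ℝ E]
    {V : Set E} {y x : E} {c : ℝ} (h : ∀ v ∈ V, ⟪y, v⟫ ≤ c) (hx : x ∈ convexHull ℝ V) :
    ⟪y, x⟫ ≤ c :=
  convexHull_min h (convex_halfSpace_le (innerₛₗ ℝ y).isLinear c) hx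

theorem inner_eq_of_mem_convexHull {E : Type*} [NormedAddCommGroup E] [InnerProductSpace ℝ E]
    {V : Set E} {y x : E} {c : ℝ} (h : ∀ v ∈ V, ⟪y, v⟫ = c) (hx : x ∈ convexHull ℝ V) :
    ⟪y, x⟫ = c :=
  convexHull_min h (convex_hyperplane (innerₛₗ ℝ y).isLinear c) hx

/-- A nonempty finite set has a point in its convex hull (its centroid) that detects the equality
`⟪a, x⟫ = 1` on the whole set. -/
theorem exists_mem_convexHull_inner_eq_one {E : Type*} [NormedAddCommGroup E]
    [InnerProductSpace ℝ E] {T : Finset E} (hT : T.Nonempty) :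
    ∃ y ∈ convexHull ℝ (T : Set E), ∀ x, (∀ a ∈ T, ⟪a, x⟫ ≤ 1) → ⟪y, x⟫ = 1 →
      ∀ a ∈ T, ⟪a, x⟫ = 1 := by
  have hc : (0 : ℝ) < T.card := by exact_mod_cast hT.card_pos
  refine ⟨∑ a ∈ T, (T.card : ℝ)⁻¹ • a, Finset.mem_convexHull'.2
    ⟨fun _ => (T.card : ℝ)⁻¹, fun _ _ => by positivity, ?_, rfl⟩, ?_⟩
  · simp [hc.ne']
  · intro x hx h1 a ha
    have h2 : ∑ a ∈ T, (1 - ⟪a, x⟫) = 0 := by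
      simp only [sum_inner, inner_smul_left, ← Finset.mul_sum] at h1
      simp only [map_inv₀, conj_trivial] at h1
      rw [inv_mul_eq_iff_eq_mul₀ hc.ne'] at h1
      simp [h1]
    have := (Finset.sum_eq_zero_iff_of_nonneg fun a ha => sub_nonneg.2 (hx a ha)).1 h2 a ha
    linarith

/-- Minimum ratio test. -/
theorem exists_first_zero {ι : Type*} (B : Finset ι) (r q : ι → ℝ) (hr : ∀ i ∈ B, r i ≤ 0)
    (hq : ∃ i ∈ B, 0 < q i) :
    ∃ s : ℝ, 0 ≤ s ∧ (∀ i ∈ B, r i + s * q i ≤ 0) ∧ ∃ i ∈ B, 0 < q i ∧ r i + s * q i = 0 := by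
  classical
  obtain ⟨i, hi, hmin⟩ := (B.filter fun i => 0 < q i).exists_min_image (fun i => -r i / q i)
    (by obtain ⟨i, hi, h⟩ := hq; exact ⟨i, by simp [hi, h]⟩)
  simp only [Finset.mem_filter] at hi hmin
  have hs : 0 ≤ -r i / q i := div_nonneg (by linarith [hr i hi.1]) hi.2.le
  refine ⟨-r i / q i, hs, fun j hj => ?_, i, hi.1, hi.2, by field_simp [hi.2.ne']; ring⟩
  rcases lt_or_ge 0 (q j) with h | h
  · have := hmin j ⟨hj, h⟩
    rw [le_div_iff₀ h] at this
    linarith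
  · nlinarith [hr j hj]

/-- Finitely many strict inequalities survive a small move. -/
theorem exists_pos_forall_add_mul_le {ι : Type*} (B : Finset ι) (r q : ι → ℝ)
    (hr : ∀ i ∈ B, r i ≤ 0) (hq : ∀ i ∈ B, r i = 0 → q i ≤ 0) :
    ∃ ε : ℝ, 0 < ε ∧ ∀ i ∈ B, r i + ε * q i ≤ 0 := by
  classical
  by_cases h : ∃ i ∈ B, 0 < q i
  · obtain ⟨s, hs0, hs, i, hi, hqi, hz⟩ := exists_first_zero B r q hr h
    refine ⟨s, lt_of_le_of_ne hs0 ?_, hs⟩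
    rintro rfl
    have := hq i hi (by linarith)
    linarith
  · push Not at h
    exact ⟨1, one_pos, fun i hi => by linarith [hr i hi, h i hi]⟩

/-- At an extreme point of a polyhedron the active constraints have full rank. -/
theorem eq_zero_of_mem_extremePoints {E : Type*} [NormedAddCommGroup E] [InnerProductSpace ℝ E]
    {A : Finset E} {x w : E} (hx : x ∈ Set.extremePoints ℝ {x : E | ∀ a ∈ A, ⟪a, x⟫ ≤ 1})
    (hw : ∀ a ∈ A, ⟪a, x⟫ = 1 → ⟪a, w⟫ = 0) : w = 0 := by
  have hxA : ∀ a ∈ A, ⟪a, x⟫ - 1 ≤ 0 := fun a ha => by linarith [hx.1 a ha]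
  obtain ⟨ε, hε, h1⟩ := exists_pos_forall_add_mul_le A (fun a => ⟪a, x⟫ - 1)
    (fun a => ⟪a, w⟫) hxA (fun a ha h => (hw a ha (by linarith)).le)
  obtain ⟨δ, hδ, h2⟩ := exists_pos_forall_add_mul_le A (fun a => ⟪a, x⟫ - 1)
    (fun a => -⟪a, w⟫) hxA (fun a ha h => by rw [hw a ha (by linarith), neg_zero])
  have e1 : x + ε • w ∈ {x : E | ∀ a ∈ A, ⟪a, x⟫ ≤ 1} := fun a ha => by
    rw [inner_add_right, inner_smul_right]; linarith [h1 a ha]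
  have e2 : x + (-δ) • w ∈ {x : E | ∀ a ∈ A, ⟪a, x⟫ ≤ 1} := fun a ha => by
    rw [inner_add_right, inner_smul_right]; linarith [h2 a ha]
  -- The weights are chosen so that the displacements `ε • w` and `-δ • w` cancel.
  have hmem : x ∈ openSegment ℝ (x + ε • w) (x + (-δ) • w) := by
    refine ⟨δ / (ε + δ), ε / (ε + δ), by positivity, by positivity, by field_simp; ring, ?_⟩
    have hne : ε + δ ≠ 0 := by positivity
    have : (δ / (ε + δ)) • (x + ε • w) + (ε / (ε + δ)) • (x + (-δ) • w)
        = ((δ + ε) / (ε + δ)) • x + ((δ * ε - ε * δ) / (ε + δ)) • w := by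
      module
    rw [this, add_comm δ ε, div_self hne, mul_comm δ ε, sub_self, zero_div, zero_smul, one_smul,
      add_zero]
  have h3 := (mem_extremePoints.1 hx).2 _ e1 _ e2 hmem
  have h4 : ε • w = 0 := by simpa using h3.1
  exact (smul_eq_zero.1 h4).resolve_left hε.ne'

/-- A polyhedron given by finitely many inequalities has finitely many extreme points. -/
theorem finite_extremePoints_of_inner_le_one {E : Type*} [NormedAddCommGroup E]
    [InnerProductSpace ℝ E] (A : Finset E) :
    (Set.extremePoints ℝ {x : E | ∀ a ∈ A, ⟪a, x⟫ ≤ 1}).Finite := by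
  classical
  -- An extreme point is determined by its set of active constraints, a subset of `A`.
  refine Set.Finite.of_finite_image
    (f := fun x => A.filter fun a => ⟪a, x⟫ = 1) (A.powerset.finite_toSet.subset ?_) ?_
  · rintro _ ⟨x, _, rfl⟩
    exact Finset.mem_coe.2 (Finset.mem_powerset.2 (Finset.filter_subset _ _))
  · intro x hx z hz hxz
    have hact : ∀ a ∈ A, ⟪a, x⟫ = 1 → ⟪a, z⟫ = 1 := by
      intro a ha h
      have : a ∈ A.filter fun a => ⟪a, x⟫ = 1 := by simp [ha, h]
      rw [show (A.filter fun a => ⟪a, x⟫ = 1) = A.filter fun a => ⟪a, z⟫ = 1 from hxz] at this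
      exact (Finset.mem_filter.1 this).2
    refine (sub_eq_zero.1 (eq_zero_of_mem_extremePoints hx fun a ha h => ?_)).symm
    rw [inner_sub_right, hact a ha h, h, sub_self]

/-- A compact convex set is the convex hull of any finite set between it and its extreme points. -/
theorem eq_convexHull_of_extremePoints_subset {E : Type*} [NormedAddCommGroup E] [NormedSpace ℝ E]
    {K X : Set E} (hK : IsCompact K) (hc : Convex ℝ K) (hX : X.Finite) (hXK : X ⊆ K)
    (h : K.extremePoints ℝ ⊆ X) : K = convexHull ℝ X := by
  refine Set.Subset.antisymm ?_ (convexHull_min hXK hc)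
  rw [← closure_convexHull_extremePoints hK hc]
  exact closure_minimal (convexHull_mono h) (hX.isClosed_convexHull ℝ)

/-! ### Polarity of convex bodies and polytopes -/

section Polar

variable {d : ℕ}

local notation "𝔼" => EuclideanSpace ℝ (Fin d)

theorem polarBody_convexHull (V : Set 𝔼) : polarBody (convexHull ℝ V) = polarBody V := by
  ext y
  refine ⟨fun h v hv => h v (subset_convexHull ℝ V hv), fun h x hx => ?_⟩
  rw [real_inner_comm]
  exact inner_le_of_mem_convexHull (fun v hv => by rw [real_inner_comm]; exact h v hv) hx

theorem isClosed_polarBody (P : Set 𝔼) : IsClosed (polarBody P) := by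
  have : polarBody P = ⋂ x ∈ P, {y | ⟪x, y⟫ ≤ 1} := by ext; simp [polarBody]
  rw [this]
  exact isClosed_biInter fun x _ => isClosed_le (by fun_prop) continuous_const

theorem convex_polarBody (P : Set 𝔼) : Convex ℝ (polarBody P) := by
  have : polarBody P = ⋂ x ∈ P, {y | ⟪x, y⟫ ≤ 1} := by ext; simp [polarBody]
  rw [this]
  exact convex_iInter₂ fun x _ => convex_halfSpace_le (innerₛₗ ℝ x).isLinear 1

theorem polarBody_polarBody {K : Set 𝔼} (hc : Convex ℝ K) (hK : IsClosed K) (h0 : 0 ∈ K) :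
    polarBody (polarBody K) = K := by
  refine Set.Subset.antisymm (fun x hx => ?_) fun x hx y hy => ?_
  · by_contra hxK
    obtain ⟨f, u, hf, hu⟩ := geometric_hahn_banach_closed_point hc hK hxK
    set y := (InnerProductSpace.toDual ℝ 𝔼).symm f with hy
    have hyf : ∀ z, ⟪y, z⟫ = f z := fun z => by simp [hy]
    have hu0 : 0 < u := by simpa using hf 0 h0
    have hyK : u⁻¹ • y ∈ polarBody K := fun z hz => by
      rw [real_inner_comm, inner_smul_left, hyf, conj_trivial, inv_mul_le_iff₀ hu0]
      linarith [hf z hz]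
    have := hx _ hyK
    rw [inner_smul_left, hyf, conj_trivial, inv_mul_le_iff₀ hu0] at this
    linarith
  · rw [real_inner_comm]; exact hy x hx

theorem isCompact_polarBody {K : Set 𝔼} (h0 : 0 ∈ interior K) : IsCompact (polarBody K) := by
  refine Metric.isCompact_of_isClosed_isBounded (isClosed_polarBody K) ?_
  obtain ⟨ε, hε, hb⟩ := Metric.mem_nhds_iff.1 (mem_interior_iff_mem_nhds.1 h0)
  refine (Metric.isBounded_iff_subset_closedBall 0).2 ⟨2 / ε, fun y hy => ?_⟩
  rw [mem_closedBall_zero_iff]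
  by_cases hy0 : y = 0
  · subst hy0; simp; positivity
  have hyn : 0 < ‖y‖ := norm_pos_iff.2 hy0
  -- The point of norm `ε / 2` in the direction of `y`; pairing it with `y` bounds `‖y‖` by `2 / ε`.
  have hm : (ε / 2 / ‖y‖) • y ∈ K := hb (by
    rw [mem_ball_zero_iff, norm_smul, Real.norm_of_nonneg (by positivity)]
    field_simp; linarith)
  have := hy _ hm
  rw [inner_smul_left, real_inner_self_eq_norm_sq, conj_trivial] at this
  have h2 : ε / 2 / ‖y‖ * ‖y‖ ^ 2 = ε / 2 * ‖y‖ := by field_simp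
  rw [h2] at this
  rw [le_div_iff₀ hε]; linarith

/-- `P` and `R` are polytopes, given as convex hulls of finite sets, that are polar to each
other. -/
structure PolarPair (P R : Set (EuclideanSpace ℝ (Fin d)))
    (V A : Finset (EuclideanSpace ℝ (Fin d))) : Prop where
  left : P = convexHull ℝ (V : Set (EuclideanSpace ℝ (Fin d)))
  right : R = convexHull ℝ (A : Set (EuclideanSpace ℝ (Fin d)))
  polar_left : polarBody P = R
  polar_right : polarBody R = P

/-- The polar is compact and has finitely many extreme points, so by Krein-Milman it is their hull.
-/
theorem exists_polarPair {P : Set 𝔼} (hP : IsConvexPolytope P) (h0 : 0 ∈ interior P) :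
    ∃ V A, PolarPair P (polarBody P) V A := by
  obtain ⟨s, hs, rfl⟩ := hP
  have h1 : polarBody (convexHull ℝ s) = {x : 𝔼 | ∀ a ∈ hs.toFinset, ⟪a, x⟫ ≤ 1} := by
    rw [polarBody_convexHull]; ext; simp [polarBody]
  have h2 := finite_extremePoints_of_inner_le_one hs.toFinset
  rw [← h1] at h2
  refine ⟨hs.toFinset, h2.toFinset, by simp, ?_, rfl,
    polarBody_polarBody (convex_convexHull ℝ s) (hs.isClosed_convexHull ℝ) (interior_subset h0)⟩
  rw [h2.coe_toFinset]
  exact eq_convexHull_of_extremePoints_subset (isCompact_polarBody h0) (convex_polarBody _) h2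
    extremePoints_subset subset_rfl

end Polar

/-! ### Duality between the faces of polar polytopes -/

section Faces

variable {d : ℕ}

local notation "𝔼" => EuclideanSpace ℝ (Fin d)

/-- The rank of a face in the face lattice: its dimension plus one, and `0` for the empty face. -/
noncomputable def faceRank (F : Set (EuclideanSpace ℝ (Fin d))) : ℕ :=
  open Classical in if F = ∅ then 0 else Module.finrank ℝ (vectorSpan ℝ F) + 1

@[simp]
theorem faceRank_empty : faceRank (∅ : Set 𝔼) = 0 := if_pos rfl

theorem faceRank_of_nonempty {F : Set 𝔼} (hF : F.Nonempty) :
    faceRank F = Module.finrank ℝ (vectorSpan ℝ F) + 1 := if_neg hF.ne_empty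

theorem hasAffineDim_iff {F : Set 𝔼} {k : ℕ} : HasAffineDim F k ↔ faceRank F = k + 1 := by
  rcases F.eq_empty_or_nonempty with rfl | h
  · simp [HasAffineDim]
  · simp [HasAffineDim, h, faceRank_of_nonempty]

/-- The linear span of a set in an affine hyperplane that misses the origin. -/
theorem finrank_span_eq_finrank_vectorSpan_add_one {S : Set 𝔼} (hS : S.Nonempty) {f : 𝔼}
    (hf : ∀ s ∈ S, ⟪f, s⟫ = 1) :
    Module.finrank ℝ (Submodule.span ℝ S) = Module.finrank ℝ (vectorSpan ℝ S) + 1 := by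
  obtain ⟨s, hs⟩ := hS
  have hle : ∀ x ∈ vectorSpan ℝ S, ⟪f, x⟫ = 0 := by
    have : vectorSpan ℝ S ≤ LinearMap.ker (innerₛₗ ℝ f) := by
      refine Submodule.span_le.2 ?_
      rintro _ ⟨a, ha, b, hb, rfl⟩
      simp [inner_sub_right, hf a ha, hf b hb]
    exact fun x hx => by simpa using this hx
  have hns : s ∉ vectorSpan ℝ S := fun h => by
    have := hle s h
    rw [hf s hs] at this
    exact one_ne_zero this
  have hs0 : s ≠ 0 := by
    rintro rfl
    exact hns (Submodule.zero_mem _)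
  have hsup : Submodule.span ℝ S = vectorSpan ℝ S ⊔ Submodule.span ℝ {s} := by
    apply le_antisymm
    · refine Submodule.span_le.2 fun a ha => ?_
      have h1 : a - s ∈ vectorSpan ℝ S := vsub_mem_vectorSpan ℝ ha hs
      rw [← sub_add_cancel a s]
      exact Submodule.add_mem_sup h1 (Submodule.mem_span_singleton_self s)
    · refine sup_le (Submodule.span_le.2 ?_)
        (Submodule.span_mono (Set.singleton_subset_iff.2 hs))
      rintro _ ⟨a, ha, b, hb, rfl⟩
      exact Submodule.sub_mem _ (Submodule.subset_span ha) (Submodule.subset_span hb)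
  have hdisj : vectorSpan ℝ S ⊓ Submodule.span ℝ {s} = ⊥ := by
    refine (Submodule.eq_bot_iff _).2 fun x hx => ?_
    obtain ⟨c, rfl⟩ := Submodule.mem_span_singleton.1 hx.2
    have := hle _ hx.1
    rw [inner_smul_right, hf s hs, mul_one] at this
    rw [this, zero_smul]
  have := Submodule.finrank_sup_add_finrank_inf_eq (vectorSpan ℝ S) (Submodule.span ℝ {s})
  rw [hdisj, finrank_bot, add_zero, finrank_span_singleton hs0] at this
  rw [hsup, this]

namespace PolarPair

variable {P R : Set (EuclideanSpace ℝ (Fin d))} {V A : Finset (EuclideanSpace ℝ (Fin d))}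

theorem symm (h : PolarPair P R V A) : PolarPair R P A V :=
  ⟨h.right, h.left, h.polar_right, h.polar_left⟩

theorem mem_left_iff (h : PolarPair P R V A) {x : 𝔼} : x ∈ P ↔ ∀ a ∈ A, ⟪a, x⟫ ≤ 1 := by
  rw [← h.polar_right, h.right, polarBody_convexHull]; rfl

theorem inner_le_one (h : PolarPair P R V A) {x y : 𝔼} (hy : y ∈ R) (hx : x ∈ P) :
    ⟪y, x⟫ ≤ 1 := by
  rw [← h.polar_right] at hx; exact hx y hy

theorem mem_left_of_forall (h : PolarPair P R V A) {x : 𝔼} (hx : ∀ y ∈ R, ⟪y, x⟫ ≤ 1) : x ∈ P := by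
  rw [← h.polar_right]; exact hx

theorem subset_left (h : PolarPair P R V A) {v : 𝔼} (hv : v ∈ V) : v ∈ P := by
  rw [h.left]; exact subset_convexHull ℝ _ hv

theorem zero_mem (h : PolarPair P R V A) : (0 : 𝔼) ∈ P := h.mem_left_iff.2 (by simp)

theorem convex_left (h : PolarPair P R V A) : Convex ℝ P := h.left ▸ convex_convexHull ℝ _

theorem exists_pos_smul_mem (h : PolarPair P R V A) (w : 𝔼) : ∃ ε : ℝ, 0 < ε ∧ ε • w ∈ P := by
  obtain ⟨ε, hε, hq⟩ := exists_pos_forall_add_mul_le A (fun _ => -1) (fun a => ⟪a, w⟫)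
    (by norm_num) (by norm_num)
  exact ⟨ε, hε, h.mem_left_iff.2 fun a ha => by rw [inner_smul_right]; linarith [hq a ha]⟩

theorem exists_inner_pos (h : PolarPair P R V A) {w : 𝔼} (hw : w ≠ 0) : ∃ a ∈ A, 0 < ⟪a, w⟫ := by
  by_contra! hc
  obtain ⟨ε, hε, hm⟩ := h.symm.exists_pos_smul_mem w
  rw [h.right] at hm
  have := inner_le_of_mem_convexHull (y := w) (c := 0)
    (fun a ha => by rw [real_inner_comm]; exact hc a ha) hm
  rw [inner_smul_right, real_inner_self_eq_norm_sq] at this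
  have : 0 < ‖w‖ := norm_pos_iff.2 hw
  have : 0 < ε * ‖w‖ ^ 2 := by positivity
  linarith

/-- For `S ⊆ R`, the set `dualFace R S` is a face of `P`, and all faces of `P` arise this way. Most
faces below are built by choosing such an `S`. -/
theorem mem_dualFace_iff (h : PolarPair P R V A) {S : Set 𝔼} {x : 𝔼} :
    x ∈ dualFace R S ↔ x ∈ P ∧ ∀ y ∈ S, ⟪y, x⟫ = 1 := by
  rw [dualFace, h.polar_right]; rfl

theorem dualFace_subset (h : PolarPair P R V A) (S : Set 𝔼) : dualFace R S ⊆ P :=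
  fun _ hx => (h.mem_dualFace_iff.1 hx).1

theorem dualFace_anti (R : Set 𝔼) {S T : Set 𝔼} (hST : S ⊆ T) : dualFace R T ⊆ dualFace R S :=
  fun _ hx => ⟨hx.1, fun y hy => hx.2 y (hST hy)⟩

theorem subset_dualFace_dualFace (h : PolarPair P R V A) {F : Set 𝔼} (hF : F ⊆ P) :
    F ⊆ dualFace R (dualFace P F) := fun x hx =>
  h.mem_dualFace_iff.2 ⟨hF hx, fun y hy => by rw [real_inner_comm]; exact hy.2 x hx⟩

theorem dualFace_eq_convexHull (h : PolarPair P R V A) {S : Set 𝔼} (hS : S ⊆ R) :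
    dualFace R S = convexHull ℝ {v | v ∈ V ∧ v ∈ dualFace R S} := by
  refine Set.Subset.antisymm (fun x hx => ?_) (convexHull_min (fun v hv => hv.2) ?_)
  · have hx' := h.mem_dualFace_iff.1 hx
    have := mem_convexHull_filter_of_inner_eq_one
      (fun s hs v hv => h.inner_le_one (hS hs) (h.subset_left hv)) (h.left ▸ hx'.1) hx'.2
    refine convexHull_mono ?_ this
    intro v hv
    exact ⟨hv.1, h.mem_dualFace_iff.2 ⟨h.subset_left hv.1, hv.2⟩⟩
  · have : dualFace R S = P ∩ ⋂ y ∈ S, {x | ⟪y, x⟫ = 1} := by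
      ext x; simp [h.mem_dualFace_iff]
    rw [this]
    exact h.convex_left.inter
      (convex_iInter₂ fun y _ => convex_hyperplane (innerₛₗ ℝ y).isLinear 1)

theorem isExposed_of_functional (h : PolarPair P R V A) {y : 𝔼} (hy : y ∈ R) :
    IsExposed ℝ P {x | x ∈ P ∧ ⟪y, x⟫ = 1} := by
  rintro ⟨x₀, hx₀, h1⟩
  refine ⟨innerSL ℝ y, ?_⟩
  ext x
  simp only [Set.mem_ofPred_eq, innerSL_apply_apply]
  refine and_congr_right fun hx => ⟨fun hx1 z hz => hx1 ▸ h.inner_le_one hy hz, fun hm => ?_⟩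
  exact le_antisymm (h.inner_le_one hy hx) (h1 ▸ hm x₀ hx₀)

theorem dualFace_eq_dualFace_filter (h : PolarPair P R V A) {S : Set 𝔼} (hS : S ⊆ R) :
    dualFace R S = dualFace R {a | a ∈ A ∧ a ∈ dualFace P (dualFace R S)} := by
  refine Set.Subset.antisymm (fun x hx => ?_) fun x hx => ?_
  · exact h.mem_dualFace_iff.2 ⟨h.dualFace_subset S hx, fun y hy => by
      rw [real_inner_comm]; exact hy.2.2 x hx⟩
  · have hx' := h.mem_dualFace_iff.1 hx
    refine h.mem_dualFace_iff.2 ⟨hx'.1, fun y hy => ?_⟩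
    have hy' : y ∈ dualFace P (dualFace R S) := h.symm.subset_dualFace_dualFace hS hy
    rw [h.symm.dualFace_eq_convexHull (h.dualFace_subset S)] at hy'
    rw [real_inner_comm]
    exact inner_eq_of_mem_convexHull (fun a ha => by rw [real_inner_comm]; exact hx'.2 a ha) hy'

/-- Only the finitely many generators of `R` in the double dual of `S` matter, and their centroid is
a single functional that equals `1` on `P` exactly where they all do. -/
theorem isExposed_dualFace (h : PolarPair P R V A) {S : Set 𝔼} (hS : S ⊆ R) :
    IsExposed ℝ P (dualFace R S) := by
  classical
  rw [h.dualFace_eq_dualFace_filter hS]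
  rcases (A.filter fun a => a ∈ dualFace P (dualFace R S)).eq_empty_or_nonempty with hT | hT
  · have : {a | a ∈ A ∧ a ∈ dualFace P (dualFace R S)} = ∅ := by
      ext a
      simpa using fun ha ha' => (Finset.eq_empty_iff_forall_notMem.1 hT a) (by simp [ha, ha'])
    rw [this]
    have : dualFace R ∅ = P := by ext x; simp [h.mem_dualFace_iff]
    rw [this]
  · obtain ⟨y, hy, hyT⟩ := exists_mem_convexHull_inner_eq_one hT
    have hyT' : y ∈ dualFace P (dualFace R S) := by
      rw [h.symm.dualFace_eq_convexHull (h.dualFace_subset S)]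
      refine convexHull_mono ?_ hy
      intro a ha
      simpa using ha
    convert h.isExposed_of_functional (h.symm.dualFace_subset _ hyT') using 1
    ext x
    rw [h.mem_dualFace_iff]
    refine and_congr_right fun hx => ⟨fun hx1 => ?_, fun hx1 a ha => ?_⟩
    · rw [real_inner_comm]
      refine inner_eq_of_mem_convexHull (fun a ha => ?_) hy
      rw [real_inner_comm]
      exact hx1 a (by simpa using ha)
    · exact hyT x (fun a ha => h.inner_le_one (h.symm.subset_left (Finset.mem_filter.1 ha).1) hx)
        hx1 a (by simpa using ha)

/-- An exposing functional has maximum at least `0`, because `0 ∈ P`. A positive maximum can be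
rescaled to `1`; a zero maximum forces the functional to vanish, so the face is `P` and `S = ∅`
works. The empty face comes from `S = {0}`. -/
theorem exists_eq_dualFace (h : PolarPair P R V A) {F : Set 𝔼} (hF : IsExposed ℝ P F) :
    ∃ S ⊆ R, F = dualFace R S := by
  rcases F.eq_empty_or_nonempty with rfl | ⟨x₀, hx₀⟩
  · refine ⟨{0}, by simpa using h.symm.zero_mem, ?_⟩
    ext x; simp [h.mem_dualFace_iff]
  obtain ⟨l, hl⟩ := hF ⟨x₀, hx₀⟩
  set y := (InnerProductSpace.toDual ℝ 𝔼).symm l with hy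
  have hyl : ∀ z, l z = ⟪y, z⟫ := fun z => by simp [hy]
  simp only [hyl] at hl
  have hx₀' := hx₀
  rw [hl] at hx₀'
  have hM : 0 ≤ ⟪y, x₀⟫ := by simpa using hx₀'.2 0 h.zero_mem
  rcases hM.eq_or_lt with hM | hM
  · have hy0 : y = 0 := by
      by_contra hne
      obtain ⟨ε, hε, hm⟩ := h.exists_pos_smul_mem y
      have := hx₀'.2 _ hm
      rw [← hM, inner_smul_right, real_inner_self_eq_norm_sq] at this
      have : 0 < ‖y‖ := norm_pos_iff.2 hne
      have : 0 < ε * ‖y‖ ^ 2 := by positivity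
      linarith
    refine ⟨∅, Set.empty_subset _, ?_⟩
    rw [hl]
    ext x; simp [h.mem_dualFace_iff, hy0]
  · refine ⟨{(⟪y, x₀⟫)⁻¹ • y}, ?_, ?_⟩
    · rw [Set.singleton_subset_iff]
      refine h.symm.mem_left_of_forall fun x hx => ?_
      rw [real_inner_comm, inner_smul_left, conj_trivial, inv_mul_le_iff₀ hM, mul_one]
      exact hx₀'.2 x hx
    · ext x
      rw [h.mem_dualFace_iff, hl]
      simp only [Set.mem_ofPred_eq, Set.mem_singleton_iff, forall_eq, inner_smul_left, conj_trivial,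
        inv_mul_eq_iff_eq_mul₀ hM.ne', mul_one]
      refine and_congr_right fun hx => ⟨fun hm => le_antisymm (hx₀'.2 x hx) (hm x₀ hx₀'.1),
        fun he z hz => he ▸ hx₀'.2 z hz⟩

theorem dualFace_dualFace (h : PolarPair P R V A) {F : Set 𝔼} (hF : IsExposed ℝ P F) :
    dualFace R (dualFace P F) = F := by
  obtain ⟨S, hS, rfl⟩ := h.exists_eq_dualFace hF
  refine Set.Subset.antisymm ?_ (h.subset_dualFace_dualFace (h.dualFace_subset S))
  exact dualFace_anti R (h.symm.subset_dualFace_dualFace hS)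

theorem isExposed_dualFace_left (h : PolarPair P R V A) {F : Set 𝔼} (hF : IsExposed ℝ P F) :
    IsExposed ℝ R (dualFace P F) := h.symm.isExposed_dualFace hF.subset

theorem dualFace_subset_dualFace_iff (h : PolarPair P R V A) {F G : Set 𝔼}
    (hF : IsExposed ℝ P F) (hG : IsExposed ℝ P G) : dualFace P F ⊆ dualFace P G ↔ G ⊆ F := by
  refine ⟨fun hs => ?_, fun hs => dualFace_anti P hs⟩
  rw [← h.dualFace_dualFace hF, ← h.dualFace_dualFace hG]
  exact dualFace_anti R hs

theorem dualFace_ssubset_dualFace_iff (h : PolarPair P R V A) {F G : Set 𝔼}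
    (hF : IsExposed ℝ P F) (hG : IsExposed ℝ P G) : dualFace P F ⊂ dualFace P G ↔ G ⊂ F := by
  rw [ssubset_iff_subset_not_subset, ssubset_iff_subset_not_subset,
    h.dualFace_subset_dualFace_iff hF hG, h.dualFace_subset_dualFace_iff hG hF]

theorem mem_face_iff (h : PolarPair P R V A) {F : Set 𝔼} (hF : IsExposed ℝ P F) {x : 𝔼} :
    x ∈ F ↔ x ∈ P ∧ ∀ y ∈ dualFace P F, ⟪y, x⟫ = 1 := by
  rw [← h.mem_dualFace_iff, h.dualFace_dualFace hF]

theorem mem_face_iff_filter (h : PolarPair P R V A) {F : Set 𝔼} (hF : IsExposed ℝ P F) {x : 𝔼} :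
    x ∈ F ↔ x ∈ P ∧ ∀ a ∈ A, a ∈ dualFace P F → ⟪a, x⟫ = 1 := by
  have := h.dualFace_eq_dualFace_filter (h.symm.dualFace_subset F)
  rw [h.dualFace_dualFace hF] at this
  conv_lhs => rw [this]
  rw [h.mem_dualFace_iff]
  simp

theorem inner_eq_one {P F : Set 𝔼} {x y : 𝔼} (hx : x ∈ F)
    (hy : y ∈ dualFace P F) : ⟪y, x⟫ = 1 := by
  rw [real_inner_comm]; exact hy.2 x hx

/-- Every nonempty face has a point that lies in no smaller face. -/
theorem exists_relative_point (h : PolarPair P R V A) {F : Set 𝔼} (hF : IsExposed ℝ P F)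
    (hne : F.Nonempty) : ∃ f ∈ F, ∀ y ∈ R, ⟪y, f⟫ = 1 → y ∈ dualFace P F := by
  classical
  have hFV : F = convexHull ℝ ((V.filter fun v => v ∈ F : Finset 𝔼) : Set 𝔼) := by
    have := h.dualFace_eq_convexHull (h.symm.dualFace_subset F)
    rw [h.dualFace_dualFace hF] at this
    rw [Finset.coe_filter]
    exact this
  have hT : (V.filter fun v => v ∈ F).Nonempty := by
    rw [hFV, convexHull_nonempty_iff] at hne
    exact_mod_cast hne
  obtain ⟨f, hf, hfT⟩ := exists_mem_convexHull_inner_eq_one hT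
  rw [← hFV] at hf
  refine ⟨f, hf, fun y hy hyf => ?_⟩
  rw [real_inner_comm] at hyf
  have h1 := hfT y (fun v hv => by
    rw [real_inner_comm]
    exact h.inner_le_one hy (h.subset_left (Finset.mem_filter.1 hv).1)) hyf
  refine h.symm.mem_dualFace_iff.2 ⟨hy, fun x hx => ?_⟩
  rw [real_inner_comm]
  rw [hFV] at hx
  exact inner_eq_of_mem_convexHull (fun v hv => by rw [real_inner_comm]; exact h1 v hv) hx

theorem exists_pos_add_smul_mem (h : PolarPair P R V A) {f w : 𝔼} (hf : f ∈ P)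
    (hw : ∀ a ∈ A, ⟪a, f⟫ = 1 → ⟪a, w⟫ ≤ 0) : ∃ ε : ℝ, 0 < ε ∧ f + ε • w ∈ P := by
  obtain ⟨ε, hε, hq⟩ := exists_pos_forall_add_mul_le A (fun a => ⟪a, f⟫ - 1) (fun a => ⟪a, w⟫)
    (fun a ha => by linarith [h.mem_left_iff.1 hf a ha]) (fun a ha h1 => hw a ha (by linarith))
  refine ⟨ε, hε, h.mem_left_iff.2 fun a ha => ?_⟩
  rw [inner_add_right, inner_smul_right]; linarith [hq a ha]

/-- At a relative interior point the constraints outside `F°` are slack, so a small move along any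
direction annihilated by `F°` stays in `F`. -/
theorem mem_vectorSpan_iff (h : PolarPair P R V A) {F : Set 𝔼} (hF : IsExposed ℝ P F)
    (hne : F.Nonempty) {w : 𝔼} :
    w ∈ vectorSpan ℝ F ↔ ∀ y ∈ dualFace P F, ⟪y, w⟫ = 0 := by
  constructor
  · intro hw y hy
    have : vectorSpan ℝ F ≤ LinearMap.ker (innerₛₗ ℝ y) := by
      refine Submodule.span_le.2 ?_
      rintro _ ⟨a, ha, b, hb, rfl⟩
      simp [inner_sub_right, inner_eq_one ha hy, inner_eq_one hb hy]
    simpa using this hw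
  · intro hw
    obtain ⟨f, hf, hfr⟩ := h.exists_relative_point hF hne
    obtain ⟨ε, hε, hm⟩ := h.exists_pos_add_smul_mem (hF.subset hf) (w := w)
      (fun a ha h1 => (hw a (hfr a (h.symm.subset_left ha) h1)).le)
    have hmF : f + ε • w ∈ F := (h.mem_face_iff hF).2 ⟨hm, fun y hy => by
      rw [inner_add_right, inner_smul_right, hw y hy, inner_eq_one hf hy, mul_zero, add_zero]⟩
    have h2 : (f + ε • w) -ᵥ f ∈ vectorSpan ℝ F := vsub_mem_vectorSpan ℝ hmF hf
    rw [vsub_eq_sub, add_sub_cancel_left] at h2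
    exact (Submodule.smul_mem_iff _ hε.ne').1 h2

theorem mem_of_sub_mem_vectorSpan (h : PolarPair P R V A) {F : Set 𝔼} (hF : IsExposed ℝ P F)
    {f x : 𝔼} (hf : f ∈ F) (hx : x ∈ P) (hxf : x - f ∈ vectorSpan ℝ F) : x ∈ F := by
  refine (h.mem_face_iff hF).2 ⟨hx, fun y hy => ?_⟩
  have := (h.mem_vectorSpan_iff hF ⟨f, hf⟩).1 hxf y hy
  rw [inner_sub_right, inner_eq_one hf hy] at this
  linarith

theorem vectorSpan_eq_orthogonal (h : PolarPair P R V A) {F : Set 𝔼} (hF : IsExposed ℝ P F)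
    (hne : F.Nonempty) : vectorSpan ℝ F = (Submodule.span ℝ (dualFace P F))ᗮ := by
  ext w
  rw [h.mem_vectorSpan_iff hF hne]
  refine ⟨fun hw => (Submodule.mem_orthogonal _ _).2 fun u hu => ?_,
    fun hw y hy => (Submodule.mem_orthogonal _ _).1 hw y (Submodule.subset_span hy)⟩
  have : Submodule.span ℝ (dualFace P F) ≤ LinearMap.ker (innerₛₗ ℝ w) :=
    Submodule.span_le.2 fun y hy => by simpa [real_inner_comm] using hw y hy
  simpa [real_inner_comm] using this hu

theorem finrank_vectorSpan_add_finrank_span (h : PolarPair P R V A) {F : Set 𝔼}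
    (hF : IsExposed ℝ P F) (hne : F.Nonempty) :
    Module.finrank ℝ (vectorSpan ℝ F) + Module.finrank ℝ (Submodule.span ℝ (dualFace P F)) = d := by
  rw [h.vectorSpan_eq_orthogonal hF hne, add_comm, Submodule.finrank_add_finrank_orthogonal,
    finrank_euclideanSpace_fin]

theorem dualFace_empty (h : PolarPair P R V A) : dualFace P ∅ = R := by
  ext x; simp [h.symm.mem_dualFace_iff]

theorem dualFace_self (h : PolarPair P R V A) : dualFace P P = ∅ := by
  refine Set.eq_empty_of_forall_notMem fun y hy => ?_
  simpa using inner_eq_one h.zero_mem hy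

theorem faceRank_left (h : PolarPair P R V A) : faceRank P = d + 1 := by
  have := h.finrank_vectorSpan_add_finrank_span (IsExposed.refl P) ⟨0, h.zero_mem⟩
  rw [h.dualFace_self, Submodule.span_empty, finrank_bot, add_zero] at this
  rw [faceRank_of_nonempty ⟨0, h.zero_mem⟩, this]

/-- The direction of `F` is the orthogonal complement of the span of `F°`. That span has dimension
one more than `F°`, which lies in a hyperplane missing the origin. -/
theorem faceRank_add_faceRank_dualFace (h : PolarPair P R V A) {F : Set 𝔼}
    (hF : IsExposed ℝ P F) : faceRank F + faceRank (dualFace P F) = d + 1 := by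
  rcases F.eq_empty_or_nonempty with rfl | ⟨f, hf⟩
  · rw [h.dualFace_empty, h.symm.faceRank_left, faceRank_empty, zero_add]
  have h1 := h.finrank_vectorSpan_add_finrank_span hF ⟨f, hf⟩
  rw [faceRank_of_nonempty ⟨f, hf⟩]
  rcases (dualFace P F).eq_empty_or_nonempty with he | hne
  · rw [he, faceRank_empty]
    rw [he, Submodule.span_empty, finrank_bot] at h1
    omega
  · rw [faceRank_of_nonempty hne]
    rw [finrank_span_eq_finrank_vectorSpan_add_one hne (f := f) (fun s hs => hs.2 f hf)] at h1
    omega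

theorem faceRank_lt (h : PolarPair P R V A) {F G : Set 𝔼} (hF : IsExposed ℝ P F)
    (hG : IsExposed ℝ P G) (hFG : F ⊂ G) : faceRank F < faceRank G := by
  obtain ⟨g, hg, hgF⟩ := Set.exists_of_ssubset hFG
  rw [faceRank_of_nonempty ⟨g, hg⟩]
  rcases F.eq_empty_or_nonempty with rfl | ⟨f, hf⟩
  · simp
  rw [faceRank_of_nonempty ⟨f, hf⟩]
  refine Nat.succ_lt_succ (Submodule.finrank_lt_finrank_of_lt
    (lt_of_le_of_ne (vectorSpan_mono ℝ hFG.1) fun he => hgF ?_))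
  refine h.mem_of_sub_mem_vectorSpan hF hf (hG.subset hg) ?_
  rw [he]
  exact vsub_mem_vectorSpan ℝ hg (hFG.1 hf)

end PolarPair

end Faces

/-! ### Faces of intermediate rank -/

namespace PolarPair

variable {d : ℕ} {P R : Set (EuclideanSpace ℝ (Fin d))} {V A : Finset (EuclideanSpace ℝ (Fin d))}

local notation "𝔼" => EuclideanSpace ℝ (Fin d)

/-- Start at a point `f` of `F` with a direction `u` into `P`, and turn the direction by multiples
of `w` until it points into a proper face `K ⊇ F` of `G`. -/
theorem exists_face_turn (h : PolarPair P R V A) {F G : Set 𝔼} (hF : IsExposed ℝ P F)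
    (hG : IsExposed ℝ P G) (hFG : F ⊆ G) {f u w : 𝔼} (hf : f ∈ F)
    (hfr : ∀ y ∈ R, ⟪y, f⟫ = 1 → y ∈ dualFace P F) (hu : u ∈ vectorSpan ℝ G)
    (hw : w ∈ vectorSpan ℝ G) (huF : ∀ a ∈ dualFace P F, ⟪a, u⟫ ≤ 0)
    (hwF : ∃ a ∈ A, a ∈ dualFace P F ∧ 0 < ⟪a, w⟫) :
    ∃ s : ℝ, 0 ≤ s ∧ ∃ ε : ℝ, 0 < ε ∧ ∃ K, IsExposed ℝ P K ∧ F ⊆ K ∧ K ⊂ G ∧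
      f + ε • (u + s • w) ∈ K ∧ ∃ b ∈ dualFace P K, 0 < ⟪b, w⟫ := by
  classical
  obtain ⟨s, hs, hs1, b, hb, hbw, hb0⟩ := exists_first_zero (A.filter fun a => a ∈ dualFace P F)
    (fun a => ⟪a, u⟫) (fun a => ⟪a, w⟫) (fun a ha => huF a (Finset.mem_filter.1 ha).2)
    (by obtain ⟨a, ha, ha', h⟩ := hwF; exact ⟨a, Finset.mem_filter.2 ⟨ha, ha'⟩, h⟩)
  simp only [Finset.mem_filter] at hs1 hb
  obtain ⟨ε, hε, hm⟩ := h.exists_pos_add_smul_mem (hF.subset hf) (w := u + s • w)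
    (fun a ha h1 => by
      rw [inner_add_right, inner_smul_right]
      exact hs1 a ⟨ha, hfr a (h.symm.subset_left ha) h1⟩)
  have hfG : G.Nonempty := ⟨f, hFG hf⟩
  -- The functionals of `F°` that stay tight along the turned ray cut out `K`. The first constraint
  -- `b` to become tight is among them, and it is positive on `w`, hence not constant on `G`.
  let T := {y | y ∈ dualFace P F ∧ ⟪y, u + s • w⟫ = 0}
  have hTF : T ⊆ dualFace P F := fun y hy => hy.1
  have hTR : T ⊆ R := hTF.trans (h.symm.dualFace_subset F)
  have hbT : b ∈ T := ⟨hb.2, by rw [inner_add_right, inner_smul_right]; exact hb0⟩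
  have hbK : b ∈ dualFace P (dualFace R T) := h.symm.subset_dualFace_dualFace hTR hbT
  have hKG : dualFace R T ⊆ G := by
    rw [← h.dualFace_dualFace hG]
    refine dualFace_anti R fun y hy => ⟨dualFace_anti P hFG hy, ?_⟩
    exact (h.mem_vectorSpan_iff hG hfG).1 (Submodule.add_mem _ hu (Submodule.smul_mem _ _ hw)) y hy
  refine ⟨s, hs, ε, hε, dualFace R T, h.isExposed_dualFace hTR, ?_,
    ssubset_iff_subset_not_subset.2 ⟨hKG, fun hGK => ?_⟩, ?_, b, hbK, hbw⟩
  · calc F = dualFace R (dualFace P F) := (h.dualFace_dualFace hF).symm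
      _ ⊆ _ := dualFace_anti R hTF
  · have := (h.mem_vectorSpan_iff hG hfG).1 hw b (dualFace_anti P hGK hbK)
    linarith
  · refine h.mem_dualFace_iff.2 ⟨hm, fun y hy => ?_⟩
    rw [inner_add_right, inner_smul_right, hy.2, inner_eq_one hf hy.1, mul_zero, add_zero]

/-- Move from a point `g` of `G` in a direction `w` parallel to `G` until the boundary of `G` is
reached. -/
theorem exists_face_move (h : PolarPair P R V A) {G : Set 𝔼} (hG : IsExposed ℝ P G) {g w : 𝔼}
    (hg : g ∈ G) (hw : w ∈ vectorSpan ℝ G) (hw0 : w ≠ 0) :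
    ∃ s : ℝ, ∃ K, IsExposed ℝ P K ∧ K ⊂ G ∧ g + s • w ∈ K ∧ ∃ b ∈ dualFace P K, 0 < ⟪b, w⟫ := by
  obtain ⟨s, hs, hs1, b, hb, hbw, hb0⟩ := exists_first_zero A (fun a => ⟪a, g⟫ - 1)
    (fun a => ⟪a, w⟫) (fun a ha => by linarith [h.mem_left_iff.1 (hG.subset hg) a ha])
    (h.exists_inner_pos hw0)
  have hbR := h.symm.subset_left hb
  have hm : g + s • w ∈ P := h.mem_left_iff.2 fun a ha => by
    rw [inner_add_right, inner_smul_right]; linarith [hs1 a ha]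
  let T := insert b (dualFace P G)
  have hTR : T ⊆ R := Set.insert_subset hbR (h.symm.dualFace_subset G)
  have hbK : b ∈ dualFace P (dualFace R T) :=
    h.symm.subset_dualFace_dualFace hTR (Set.mem_insert _ _)
  refine ⟨s, dualFace R T, h.isExposed_dualFace hTR,
    ssubset_iff_subset_not_subset.2 ⟨?_, fun hGK => ?_⟩, ?_, b, hbK, hbw⟩
  · calc dualFace R T ⊆ dualFace R (dualFace P G) := dualFace_anti R (Set.subset_insert _ _)
      _ = G := h.dualFace_dualFace hG
  · have := (h.mem_vectorSpan_iff hG ⟨g, hg⟩).1 hw b (dualFace_anti P hGK hbK)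
    linarith
  · refine h.mem_dualFace_iff.2 ⟨hm, fun y hy => ?_⟩
    rw [inner_add_right, inner_smul_right]
    rcases hy with rfl | hy
    · linarith
    · rw [(h.mem_vectorSpan_iff hG ⟨g, hg⟩).1 hw y hy, inner_eq_one hg hy, mul_zero, add_zero]

theorem exists_filter_inner_lt_one (h : PolarPair P R V A) {F : Set 𝔼} (hF : IsExposed ℝ P F)
    {p : 𝔼} (hp : p ∈ P) (hpF : p ∉ F) : ∃ a ∈ A, a ∈ dualFace P F ∧ ⟪a, p⟫ < 1 := by
  by_contra! hc
  refine hpF ((h.mem_face_iff_filter hF).2 ⟨hp, fun a ha haF => ?_⟩)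
  exact le_antisymm (h.mem_left_iff.1 hp a ha) (hc a ha haF)

theorem mem_vectorSpan_of_add_smul_mem {F : Set 𝔼}
    {f w : 𝔼} {ε : ℝ} (hε : 0 < ε) (hf : f ∈ F) (hw : f + ε • w ∈ F) : w ∈ vectorSpan ℝ F := by
  have h2 : (f + ε • w) -ᵥ f ∈ vectorSpan ℝ F := vsub_mem_vectorSpan ℝ hw hf
  rw [vsub_eq_sub, add_sub_cancel_left] at h2
  exact (Submodule.smul_mem_iff _ hε.ne').1 h2

/-- A rank gap of two leaves a direction `w` of `G` outside the span of the direction of `F` and `g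
- f`. Turning `g - f` by `w` or `-w` hits a proper face of `G`, and the turned vector cannot fall
back into the direction of `F`. -/
theorem exists_face_between (h : PolarPair P R V A) {F G : Set 𝔼} (hF : IsExposed ℝ P F)
    (hG : IsExposed ℝ P G) (hFG : F ⊂ G) (hr : faceRank F + 2 ≤ faceRank G) :
    ∃ K, IsExposed ℝ P K ∧ F ⊂ K ∧ K ⊂ G := by
  obtain ⟨g, hg, hgF⟩ := Set.exists_of_ssubset hFG
  rw [faceRank_of_nonempty ⟨g, hg⟩] at hr
  rcases F.eq_empty_or_nonempty with rfl | hne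
  · rw [faceRank_empty] at hr
    have : Nontrivial (vectorSpan ℝ G) := Module.nontrivial_of_finrank_pos (R := ℝ) (by omega)
    obtain ⟨w, hw⟩ := exists_ne (0 : vectorSpan ℝ G)
    obtain ⟨s, K, hK, hKG, hm, -⟩ := h.exists_face_move hG hg w.2 (by simpa using hw)
    exact ⟨K, hK, Set.empty_ssubset.2 ⟨_, hm⟩, hKG⟩
  · obtain ⟨f, hf, hfr⟩ := h.exists_relative_point hF hne
    rw [faceRank_of_nonempty hne] at hr
    obtain ⟨w, hw, hwn⟩ : ∃ w ∈ vectorSpan ℝ G,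
        w ∉ vectorSpan ℝ F ⊔ Submodule.span ℝ {g - f} := by
      refine Set.not_subset.1 fun hle => ?_
      have h1 := Submodule.finrank_mono (show vectorSpan ℝ G ≤ _ from hle)
      have h2 := Submodule.finrank_add_le_finrank_add_finrank (vectorSpan ℝ F)
        (Submodule.span ℝ {g - f})
      have h3 := finrank_span_le_card (R := ℝ) ({g - f} : Set 𝔼)
      simp at h3
      omega
    have hwF : w ∉ vectorSpan ℝ F := fun hc => hwn (Submodule.mem_sup_left hc)
    have hu : g - f ∈ vectorSpan ℝ G := vsub_mem_vectorSpan ℝ hg (hFG.1 hf)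
    have huF : ∀ a ∈ dualFace P F, ⟪a, g - f⟫ ≤ 0 := fun a ha => by
      rw [inner_sub_right, inner_eq_one hf ha]
      linarith [h.inner_le_one (h.symm.dualFace_subset F ha) (hG.subset hg)]
    have key : ∀ w ∈ vectorSpan ℝ G, w ∉ vectorSpan ℝ F ⊔ Submodule.span ℝ {g - f} →
        (∃ a ∈ A, a ∈ dualFace P F ∧ 0 < ⟪a, w⟫) → ∃ K, IsExposed ℝ P K ∧ F ⊂ K ∧ K ⊂ G := by
      intro w hw hwn hpos
      obtain ⟨s, hs, ε, hε, K, hK, hFK, hKG, hm, -⟩ :=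
        h.exists_face_turn hF hG hFG.1 hf hfr hu hw huF hpos
      refine ⟨K, hK, lt_of_le_of_ne hFK ?_, hKG⟩
      rintro rfl
      have h1 := mem_vectorSpan_of_add_smul_mem hε hf hm
      rcases eq_or_ne s 0 with rfl | hs0
      · rw [zero_smul, add_zero] at h1
        exact hgF (h.mem_of_sub_mem_vectorSpan hF hf (hG.subset hg) h1)
      · refine hwn ((Submodule.smul_mem_iff _ hs0).1 ?_)
        rw [← add_sub_cancel_left (g - f) (s • w)]
        exact Submodule.sub_mem _ (Submodule.mem_sup_left h1)
          (Submodule.mem_sup_right (Submodule.mem_span_singleton_self _))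
    -- If neither `w` nor `-w` can be used, all of `F°` annihilates `w`, putting `w` in the
    -- direction of `F`.
    by_contra hc
    refine hwF ((h.mem_vectorSpan_iff hF hne).2 fun y hy => ?_)
    have hA : ∀ a ∈ A, a ∈ dualFace P F → ⟪w, a⟫ = 0 := fun a ha haF => by
      rw [real_inner_comm]
      refine le_antisymm (not_lt.1 fun hlt => hc (key w hw hwn ⟨a, ha, haF, hlt⟩))
        (not_lt.1 fun hlt => hc (key (-w) (Submodule.neg_mem _ hw) ?_ ⟨a, ha, haF, ?_⟩))
      · rwa [Submodule.neg_mem_iff]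
      · rw [inner_neg_right]; linarith
    rw [h.symm.dualFace_eq_convexHull hF.subset] at hy
    rw [real_inner_comm]
    exact inner_eq_of_mem_convexHull (fun a ha => hA a ha.1 ha.2) hy

/-- If the given face contains `p`, turn away from `p` instead: the resulting face has a constraint
`b` increasing in the direction away from `p`, so `b` cannot be tight at `p`. -/
theorem exists_face_between_not_mem (h : PolarPair P R V A) {F K₀ G : Set 𝔼}
    (hF : IsExposed ℝ P F) (hK₀ : IsExposed ℝ P K₀) (hG : IsExposed ℝ P G) (hFK : F ⊂ K₀)
    (hKG : K₀ ⊂ G) {p : 𝔼} (hpF : p ∉ F) : ∃ K, IsExposed ℝ P K ∧ F ⊂ K ∧ K ⊂ G ∧ p ∉ K := by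
  by_cases hpK : p ∈ K₀
  swap
  · exact ⟨K₀, hK₀, hFK, hKG, hpK⟩
  obtain ⟨g, hg, hgK⟩ := Set.exists_of_ssubset hKG
  have hpG := hKG.1 hpK
  rcases F.eq_empty_or_nonempty with rfl | hne
  · have hgp : g - p ≠ 0 := fun hc => hgK (by rwa [sub_eq_zero.1 hc])
    obtain ⟨s, K, hK, hKG', hm, b, hb, hbw⟩ :=
      h.exists_face_move hG hg (w := g - p) (vsub_mem_vectorSpan ℝ hg hpG) hgp
    refine ⟨K, hK, Set.empty_ssubset.2 ⟨_, hm⟩, hKG', fun hpK' => ?_⟩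
    have h1 := h.inner_le_one (h.symm.dualFace_subset K hb) (hG.subset hg)
    rw [inner_sub_right, inner_eq_one hpK' hb] at hbw
    linarith
  · obtain ⟨f, hf, hfr⟩ := h.exists_relative_point hF hne
    have hfG := hKG.1 (hFK.1 hf)
    obtain ⟨a, ha, haF, hap⟩ := h.exists_filter_inner_lt_one hF (hG.subset hpG) hpF
    obtain ⟨s, hs, ε, hε, K, hK, hFK', hKG', hm, b, hb, hbw⟩ :=
      h.exists_face_turn hF hG (hFK.1.trans hKG.1) hf hfr (u := g - f) (w := f - p)
        (vsub_mem_vectorSpan ℝ hg hfG) (vsub_mem_vectorSpan ℝ hfG hpG)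
        (fun a ha => by
          rw [inner_sub_right, inner_eq_one hf ha]
          linarith [h.inner_le_one (h.symm.dualFace_subset F ha) (hG.subset hg)])
        ⟨a, ha, haF, by rw [inner_sub_right, inner_eq_one hf haF]; linarith⟩
    refine ⟨K, hK, lt_of_le_of_ne hFK' ?_, hKG', fun hpK' => ?_⟩
    · rintro rfl
      have h1 := vectorSpan_mono ℝ hFK.1 (mem_vectorSpan_of_add_smul_mem hε hf hm)
      have h2 : f - p ∈ vectorSpan ℝ K₀ := vsub_mem_vectorSpan ℝ (hFK.1 hf) hpK
      refine hgK (h.mem_of_sub_mem_vectorSpan hK₀ (hFK.1 hf) (hG.subset hg) ?_)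
      rw [← add_sub_cancel_right (g - f) (s • (f - p))]
      exact Submodule.sub_mem _ h1 (Submodule.smul_mem _ _ h2)
    · rw [inner_sub_right, inner_eq_one hpK' hb, inner_eq_one (hFK' hf) hb] at hbw
      linarith

theorem exists_face_of_rank (h : PolarPair P R V A) {F G : Set 𝔼} (hF : IsExposed ℝ P F)
    (hG : IsExposed ℝ P G) (hFG : F ⊂ G) {k : ℕ} (hFk : faceRank F < k) (hkG : k < faceRank G) :
    ∃ K, IsExposed ℝ P K ∧ F ⊂ K ∧ K ⊂ G ∧ faceRank K = k := by
  induction hn : faceRank G - faceRank F using Nat.strong_induction_on generalizing F G with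
  | _ n ih =>
    obtain ⟨K, hK, hFK, hKG⟩ := h.exists_face_between hF hG hFG (by omega)
    have h1 := h.faceRank_lt hF hK hFK
    have h2 := h.faceRank_lt hK hG hKG
    rcases lt_trichotomy (faceRank K) k with hlt | heq | hgt
    · obtain ⟨K', hK', a, b, c⟩ := ih _ (by omega) hK hG hKG hlt hkG rfl
      exact ⟨K', hK', hFK.trans a, b, c⟩
    · exact ⟨K, hK, hFK, hKG, heq⟩
    · obtain ⟨K', hK', a, b, c⟩ := ih _ (by omega) hF hK hFK hFk hgt rfl
      exact ⟨K', hK', a, b.trans hKG, c⟩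

/-- A face `F` of `G` is the intersection of the faces of rank `k` between `F` and `G`. -/
theorem exists_face_of_rank_not_mem (h : PolarPair P R V A) {F G : Set 𝔼} (hF : IsExposed ℝ P F)
    (hG : IsExposed ℝ P G) (hFG : F ⊂ G) {k : ℕ} (hFk : faceRank F < k) (hkG : k < faceRank G)
    {p : 𝔼} (hp : p ∉ F) :
    ∃ K, IsExposed ℝ P K ∧ F ⊂ K ∧ K ⊂ G ∧ faceRank K = k ∧ p ∉ K := by
  induction hn : faceRank G - faceRank F using Nat.strong_induction_on generalizing F with
  | _ n ih =>
    obtain ⟨K₀, hK₀, hFK₀, hK₀G, -⟩ := h.exists_face_of_rank hF hG hFG hFk hkG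
    obtain ⟨K, hK, hFK, hKG, hpK⟩ := h.exists_face_between_not_mem hF hK₀ hG hFK₀ hK₀G hp
    have h1 := h.faceRank_lt hF hK hFK
    have h2 := h.faceRank_lt hK hG hKG
    rcases lt_trichotomy (faceRank K) k with hlt | heq | hgt
    · obtain ⟨K', hK', a, b, c⟩ := ih _ (by omega) hK hKG hlt hpK rfl
      exact ⟨K', hK', hFK.trans a, b, c⟩
    · exact ⟨K, hK, hFK, hKG, heq, hpK⟩
    -- Any face of rank `k` inside `K` avoids `p` because `K` does.
    · obtain ⟨K', hK', a, b, c⟩ := h.exists_face_of_rank hF hK hFK hFk hgt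
      exact ⟨K', hK', a, b.trans hKG, c, fun hc => hpK (b.1 hc)⟩

/-- The rank of an element of the face lattice. -/
theorem height_eq_faceRank (h : PolarPair P R V A) (F : FaceLattice P) :
    Order.height F = faceRank F.1 := by
  apply le_antisymm
  · have := Order.height_le_height_apply_of_strictMono (fun F : FaceLattice P => faceRank F.1)
      (fun F G hFG => h.faceRank_lt F.2 G.2 hFG) F
    simpa using this
  · induction hn : faceRank F.1 generalizing F with
    | zero => simp
    | succ n ih =>
      obtain ⟨K, hK, hKF, hKn⟩ : ∃ K, IsExposed ℝ P K ∧ K ⊂ F.1 ∧ faceRank K = n := by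
        have hne : F.1.Nonempty := Set.nonempty_iff_ne_empty.2 fun he => by simp [he] at hn
        rcases Nat.eq_zero_or_pos n with rfl | hpos
        · exact ⟨∅, isExposed_empty, Set.empty_ssubset.2 hne, faceRank_empty⟩
        · obtain ⟨K, hK, -, hKF, hr⟩ := h.exists_face_of_rank isExposed_empty F.2
            (Set.empty_ssubset.2 hne) (by simpa using hpos) (k := n) (by omega)
          exact ⟨K, hK, hKF, hr⟩
      have h1 := ih ⟨K, hK⟩ hKn
      have h2 := Order.height_add_one_le (a := (⟨K, hK⟩ : FaceLattice P)) (b := F) hKF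
      push_cast
      exact (add_le_add_left h1 1).trans h2

/-- A functional that is constant on the face `F` and takes a smaller value somewhere on every
larger face takes smaller values on all of `P \ F`. -/
theorem inner_lt_of_forall_face (h : PolarPair P R V A) {F : Set 𝔼} (hF : IsExposed ℝ P F)
    (hne : F.Nonempty) {l : 𝔼} {c : ℝ} (hl : ∀ x ∈ F, ⟪l, x⟫ = c)
    (hlt : ∀ H, IsExposed ℝ P H → F ⊂ H → ∃ q ∈ H, ⟪l, q⟫ < c) {p : 𝔼} (hp : p ∈ P)
    (hpF : p ∉ F) : ⟪l, p⟫ < c := by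
  obtain ⟨f, hf, hfr⟩ := h.exists_relative_point hF hne
  suffices ∀ n, ∀ H, IsExposed ℝ P H → F ⊆ H → faceRank H = n → ∀ p ∈ H, p ∉ F → ⟪l, p⟫ < c from
    this _ P (IsExposed.refl P) hF.subset rfl p hp hpF
  intro n
  induction n using Nat.strong_induction_on with
  | _ n ih =>
    intro H hH hFH hn p hp hpF
    by_contra! hcp
    obtain ⟨q, hq, hqc⟩ := hlt H hH (ssubset_iff_subset_not_subset.2 ⟨hFH, fun hc => hpF (hc hp)⟩)
    have hqF : q ∉ F := fun hc => hqc.ne (hl q hc)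
    obtain ⟨a, ha, haF, haq⟩ := h.exists_filter_inner_lt_one hF (hH.subset hq) hqF
    -- Turning away from `q` does not lower `l`, so the new point still has value at least `c` and
    -- lies in a smaller face `K`, where induction applies unless it is already in `F`.
    obtain ⟨s, hs, ε, hε, K, hK, hFK, hKH, hm, -⟩ :=
      h.exists_face_turn hF hH hFH hf hfr (u := p - f) (w := f - q)
        (vsub_mem_vectorSpan ℝ hp (hFH hf)) (vsub_mem_vectorSpan ℝ (hFH hf) hq)
        (fun a ha => by
          rw [inner_sub_right, inner_eq_one hf ha]
          linarith [h.inner_le_one (h.symm.dualFace_subset F ha) (hH.subset hp)])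
        ⟨a, ha, haF, by rw [inner_sub_right, inner_eq_one hf haF]; linarith⟩
    have hval : ⟪l, f + ε • (p - f + s • (f - q))⟫ =
        c + ε * ((⟪l, p⟫ - c) + s * (c - ⟪l, q⟫)) := by
      simp only [inner_add_right, inner_smul_right, inner_sub_right, hl f hf]
    have hsq : 0 ≤ s * (c - ⟪l, q⟫) := mul_nonneg hs (by linarith)
    by_cases hmF : f + ε • (p - f + s • (f - q)) ∈ F
    · rw [hl _ hmF] at hval
      have h0 : ε * ((⟪l, p⟫ - c) + s * (c - ⟪l, q⟫)) = 0 := by linarith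
      have h1 := (mul_eq_zero.1 h0).resolve_left hε.ne'
      have h2 : s * (c - ⟪l, q⟫) = 0 := by linarith
      have hs0 : s = 0 := (mul_eq_zero.1 h2).resolve_right (by linarith)
      rw [hs0, zero_smul, add_zero] at hmF
      exact hpF (h.mem_of_sub_mem_vectorSpan hF hf (hH.subset hp)
        (mem_vectorSpan_of_add_smul_mem hε hf hmF))
    · have h1 := ih _ (hn ▸ h.faceRank_lt hK hH hKH) K hK hFK rfl _ hm hmF
      rw [hval] at h1
      have : 0 ≤ ε * ((⟪l, p⟫ - c) + s * (c - ⟪l, q⟫)) :=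
        mul_nonneg hε.le (by linarith)
      linarith

end PolarPair

/-! ### Tangent faces and the extreme points of `P ∩ R` -/

section Tangent

variable {d : ℕ}

local notation "𝔼" => EuclideanSpace ℝ (Fin d)

/-- The face `F` is tangent to the unit sphere at `x`. -/
def TangentAt (F : Set (EuclideanSpace ℝ (Fin d))) (x : EuclideanSpace ℝ (Fin d)) : Prop :=
  x ∈ F ∧ ‖x‖ = 1 ∧ ∀ y ∈ F, ⟪x, y⟫ = 1

theorem isTangentToUnitSphere_iff {F : Set 𝔼} : IsTangentToUnitSphere F ↔ ∃ x, TangentAt F x := by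
  simp [IsTangentToUnitSphere, TangentAt]

theorem mem_facesOfDim_iff {P F : Set 𝔼} {k : ℕ} :
    F ∈ facesOfDim P k ↔ IsExposed ℝ P F ∧ faceRank F = k + 1 := by
  rw [← hasAffineDim_iff]; rfl

/-- Equality in Cauchy-Schwarz; this is what identifies tangent points with one another and with
extreme points. -/
theorem eq_of_inner_eq_one {E : Type*} [NormedAddCommGroup E] [InnerProductSpace ℝ E] {x c : E}
    (hx : ‖x‖ = 1) (hc : ⟪c, c⟫ ≤ 1) (h : ⟪x, c⟫ = 1) : c = x := by
  have h1 : ‖x - c‖ ^ 2 ≤ 0 := by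
    rw [norm_sub_sq_real, h, hx, ← real_inner_self_eq_norm_sq c]; linarith
  have h2 : ‖x - c‖ = 0 := by nlinarith [norm_nonneg (x - c)]
  exact (sub_eq_zero.1 (norm_eq_zero.1 h2)).symm

theorem TangentAt.inner_self {F : Set 𝔼} {x : 𝔼} (hx : TangentAt F x) : ⟪x, x⟫ = 1 := hx.2.2 x hx.1

theorem TangentAt.inner_lt_one {F K : Set 𝔼} {x y : 𝔼} (hx : TangentAt F x) (hy : TangentAt K y)
    (hne : x ≠ y) : ⟪x, y⟫ < 1 := by
  refine lt_of_le_of_ne ?_ fun h => hne (eq_of_inner_eq_one hx.2.1 hy.inner_self.le h).symm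
  have := real_inner_le_norm x y
  rwa [hx.2.1, hy.2.1, one_mul] at this

/-- All `t`-faces of `P` are tangent to the unit sphere, where `P` and `R` are polar polytopes. -/
structure TangentPair (t : ℕ) (P R : Set (EuclideanSpace ℝ (Fin d)))
    (V A : Finset (EuclideanSpace ℝ (Fin d))) : Prop extends PolarPair P R V A where
  lt_dim : t < d
  tangent : ∀ F, IsExposed ℝ P F → faceRank F = t + 1 → ∃ x, TangentAt F x

namespace TangentPair

variable {t : ℕ} {P R : Set (EuclideanSpace ℝ (Fin d))}
  {V A : Finset (EuclideanSpace ℝ (Fin d))}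

theorem inner_lt_one (h : TangentPair t P R V A) {F : Set 𝔼} (hF : IsExposed ℝ P F)
    (hFt : faceRank F = t + 1) {x : 𝔼} (hx : TangentAt F x) {p : 𝔼} (hp : p ∈ P) (hpF : p ∉ F) :
    ⟪x, p⟫ < 1 := by
  refine h.inner_lt_of_forall_face hF ⟨x, hx.1⟩ hx.2.2 (fun H hH hFH => ?_) hp hpF
  obtain ⟨K, hK, -, hKH, hKt, hxK⟩ := h.exists_face_of_rank_not_mem isExposed_empty hH
    (Set.empty_ssubset.2 ⟨x, hFH.1 hx.1⟩) (k := t + 1) (by simp) (hFt ▸ h.faceRank_lt hF hH hFH)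
    (Set.notMem_empty x)
  obtain ⟨q, hq⟩ := h.tangent K hK hKt
  exact ⟨q, hKH.1 hq.1, hx.inner_lt_one hq fun hc => hxK (hc ▸ hq.1)⟩

theorem inner_le_one_of_tangentAt (h : TangentPair t P R V A) {F : Set 𝔼} (hF : IsExposed ℝ P F)
    (hFt : faceRank F = t + 1) {x : 𝔼} (hx : TangentAt F x) {p : 𝔼} (hp : p ∈ P) :
    ⟪x, p⟫ ≤ 1 := by
  by_cases hpF : p ∈ F
  · exact (hx.2.2 p hpF).le
  · exact (h.inner_lt_one hF hFt hx hp hpF).le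

theorem mem_dualFace (h : TangentPair t P R V A) {F : Set 𝔼} (hF : IsExposed ℝ P F)
    (hFt : faceRank F = t + 1) {x : 𝔼} (hx : TangentAt F x) : x ∈ dualFace P F := by
  refine h.symm.mem_dualFace_iff.2 ⟨h.symm.mem_left_of_forall fun p hp => ?_, fun p hp => ?_⟩
  · rw [real_inner_comm]; exact h.inner_le_one_of_tangentAt hF hFt hx hp
  · rw [real_inner_comm]; exact hx.2.2 p hp

theorem inner_eq_one_iff_mem_face (h : TangentPair t P R V A) {F : Set 𝔼} (hF : IsExposed ℝ P F)
    (hFt : faceRank F = t + 1) {x : 𝔼} (hx : TangentAt F x) {p : 𝔼} (hp : p ∈ P) :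
    ⟪x, p⟫ = 1 ↔ p ∈ F :=
  ⟨fun h1 => by_contra fun hpF => (h.inner_lt_one hF hFt hx hp hpF).ne h1, hx.2.2 p⟩

/-- The tangent point of a face lies in no smaller face. -/
theorem inner_eq_one_iff_mem_dualFace (h : TangentPair t P R V A) {F : Set 𝔼}
    (hF : IsExposed ℝ P F) (hFt : faceRank F = t + 1) {x : 𝔼} (hx : TangentAt F x) {y : 𝔼}
    (hy : y ∈ R) : ⟪x, y⟫ = 1 ↔ y ∈ dualFace P F := by
  refine ⟨fun hxy => ?_, fun hyF => hyF.2 x hx.1⟩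
  have hTR : insert y (dualFace P F) ⊆ R := Set.insert_subset hy (h.symm.dualFace_subset F)
  have hKe := h.isExposed_dualFace hTR
  have hyK : y ∈ dualFace P (dualFace R (insert y (dualFace P F))) :=
    h.symm.subset_dualFace_dualFace hTR (Set.mem_insert _ _)
  have hxK : x ∈ dualFace R (insert y (dualFace P F)) := by
    refine h.mem_dualFace_iff.2 ⟨hF.subset hx.1, ?_⟩
    rintro z (rfl | hz)
    · rwa [real_inner_comm]
    · exact PolarPair.inner_eq_one hx.1 hz
  have hKF : dualFace R (insert y (dualFace P F)) ⊆ F := by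
    conv_rhs => rw [← h.dualFace_dualFace hF]
    exact PolarPair.dualFace_anti R (Set.subset_insert _ _)
  generalize dualFace R (insert y (dualFace P F)) = K at *
  by_contra hyF
  have hKF' : K ⊂ F := ssubset_iff_subset_not_subset.2
    ⟨hKF, fun hc => hyF (PolarPair.dualFace_anti P hc hyK)⟩
  obtain ⟨p, hp, hpK⟩ := Set.exists_of_ssubset hKF'
  have hlt := h.faceRank_lt hKe hF hKF'
  have hP := h.faceRank_left
  have htd := h.lt_dim
  -- A `t`-face through `K` that misses a point `p` of `F`. It contains `x`, so it is tangent at `x`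
  -- too; but then `⟪x, p⟫ = 1` would put `p` into it.
  obtain ⟨F', hF', hKF', -, hFt', hpF'⟩ := h.exists_face_of_rank_not_mem hKe (IsExposed.refl P)
    (hKF'.trans_subset hF.subset) (k := t + 1) (by omega) (by omega) hpK
  obtain ⟨x', hx'⟩ := h.tangent F' hF' hFt'
  obtain rfl : x = x' := eq_of_inner_eq_one hx'.2.1 hx.inner_self.le (hx'.2.2 x (hKF'.1 hxK))
  exact (h.inner_lt_one hF' hFt' hx' (hF.subset hp) hpF').ne (hx.2.2 p hp)

theorem exists_tangentAt_of_mem_extremePoints (h : TangentPair t P R V A) {c : 𝔼}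
    (hc : c ∈ Set.extremePoints ℝ (P ∩ R)) :
    ∃ F, IsExposed ℝ P F ∧ faceRank F = t + 1 ∧ TangentAt F c := by
  classical
  have hcc : ⟪c, c⟫ ≤ 1 := h.inner_le_one hc.1.2 hc.1.1
  have htd := h.lt_dim
  -- The constraints active at `c`; their dual faces are the smallest faces of `P` and `R`
  -- containing `c`.
  let SZ := {y | y ∈ R ∧ ⟪y, c⟫ = 1}
  let SW := {x | x ∈ P ∧ ⟪x, c⟫ = 1}
  have hZ : IsExposed ℝ P (dualFace R SZ) := h.isExposed_dualFace fun y hy => hy.1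
  have hW : IsExposed ℝ R (dualFace P SW) := h.symm.isExposed_dualFace fun y hy => hy.1
  have hcZ : c ∈ dualFace R SZ := h.mem_dualFace_iff.2 ⟨hc.1.1, fun y hy => hy.2⟩
  have hcW : c ∈ dualFace P SW := h.symm.mem_dualFace_iff.2 ⟨hc.1.2, fun y hy => hy.2⟩
  by_cases hZt : faceRank (dualFace R SZ) ≤ t + 1
  · obtain ⟨F, hF, hZF, hFt⟩ : ∃ F, IsExposed ℝ P F ∧ dualFace R SZ ⊆ F ∧ faceRank F = t + 1 := by
      rcases hZt.eq_or_lt with heq | hlt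
      · exact ⟨_, hZ, subset_rfl, heq⟩
      · have hP := h.faceRank_left
        have hZP : dualFace R SZ ⊂ P := lt_of_le_of_ne hZ.subset fun he => by
          rw [he] at hlt; omega
        obtain ⟨F, hF, hZF, -, hFt⟩ :=
          h.exists_face_of_rank hZ (IsExposed.refl P) hZP hlt (by omega)
        exact ⟨F, hF, hZF.1, hFt⟩
    obtain ⟨x, hx⟩ := h.tangent F hF hFt
    obtain rfl := eq_of_inner_eq_one hx.2.1 hcc (hx.2.2 c (hZF hcZ))
    exact ⟨F, hF, hFt, hx⟩
  by_cases hWt : faceRank (dualFace P SW) ≤ d - t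
  · obtain ⟨K, hK, hWK, hKt⟩ : ∃ K, IsExposed ℝ R K ∧ dualFace P SW ⊆ K ∧ faceRank K = d - t := by
      rcases hWt.eq_or_lt with heq | hlt
      · exact ⟨_, hW, subset_rfl, heq⟩
      · have hR := h.symm.faceRank_left
        have hWR : dualFace P SW ⊂ R := lt_of_le_of_ne hW.subset fun he => by
          rw [he] at hlt; omega
        obtain ⟨K, hK, hWK, -, hKt⟩ :=
          h.symm.exists_face_of_rank hW (IsExposed.refl R) hWR hlt (by omega)
        exact ⟨K, hK, hWK.1, hKt⟩
    have hsum := h.symm.faceRank_add_faceRank_dualFace hK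
    have hFt : faceRank (dualFace R K) = t + 1 := by omega
    have hF := h.symm.isExposed_dualFace_left hK
    obtain ⟨x, hx⟩ := h.tangent _ hF hFt
    obtain rfl := eq_of_inner_eq_one hx.2.1 hcc (PolarPair.inner_eq_one (hWK hcW) hx.1)
    exact ⟨_, hF, hFt, hx⟩
  -- Both dimensions are now too large: they add up to more than `d`, so the directions share a
  -- nonzero `w` annihilated by all active constraints, against extremality.
  exfalso
  rw [faceRank_of_nonempty ⟨c, hcZ⟩] at hZt
  rw [faceRank_of_nonempty ⟨c, hcW⟩] at hWt
  have h1 := Submodule.finrank_sup_add_finrank_inf_eq (vectorSpan ℝ (dualFace R SZ))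
    (vectorSpan ℝ (dualFace P SW))
  have h2 := Submodule.finrank_le (vectorSpan ℝ (dualFace R SZ) ⊔ vectorSpan ℝ (dualFace P SW))
  rw [finrank_euclideanSpace_fin] at h2
  have : Nontrivial ↥(vectorSpan ℝ (dualFace R SZ) ⊓ vectorSpan ℝ (dualFace P SW)) :=
    Module.nontrivial_of_finrank_pos (R := ℝ) (by omega)
  obtain ⟨w, hw⟩ := exists_ne
    (0 : ↥(vectorSpan ℝ (dualFace R SZ) ⊓ vectorSpan ℝ (dualFace P SW)))
  have hPR : P ∩ R = {x : 𝔼 | ∀ a ∈ A ∪ V, ⟪a, x⟫ ≤ 1} := by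
    ext x
    simp only [Set.mem_inter_iff, h.mem_left_iff, h.symm.mem_left_iff, Set.mem_ofPred_eq,
      Finset.mem_union, or_imp, forall_and]
  rw [hPR] at hc
  refine hw (Subtype.ext (eq_zero_of_mem_extremePoints hc fun a ha hac => ?_))
  rcases Finset.mem_union.1 ha with ha | ha
  · refine (h.mem_vectorSpan_iff hZ ⟨c, hcZ⟩).1 w.2.1 a ?_
    exact h.symm.subset_dualFace_dualFace (fun y hy => hy.1) ⟨h.symm.subset_left ha, hac⟩
  · refine (h.symm.mem_vectorSpan_iff hW ⟨c, hcW⟩).1 w.2.2 a ?_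
    exact h.subset_dualFace_dualFace (fun y hy => hy.1) ⟨h.subset_left ha, hac⟩

/-- The hull of `P` and its polar is a polytope, and its facets are cut out by tangent
hyperplanes at tangent points. -/
theorem exists_polarPair_hull [DecidableEq (EuclideanSpace ℝ (Fin d))]
    (h : TangentPair t P R V A) : ∃ X : Finset 𝔼,
      PolarPair (convexHull ℝ (P ∪ R)) (P ∩ R) (V ∪ A) X ∧
      ∀ x ∈ X, ∃ F, IsExposed ℝ P F ∧ faceRank F = t + 1 ∧ TangentAt F x := by
  have hPR : P ∩ R = {x : 𝔼 | ∀ a ∈ A ∪ V, ⟪a, x⟫ ≤ 1} := by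
    ext x
    simp only [Set.mem_inter_iff, h.mem_left_iff, h.symm.mem_left_iff, Set.mem_ofPred_eq,
      Finset.mem_union, or_imp, forall_and]
  have hfin : (Set.extremePoints ℝ (P ∩ R)).Finite := by
    rw [hPR]; exact finite_extremePoints_of_inner_le_one _
  have hQ : convexHull ℝ (P ∪ R) = convexHull ℝ ((V ∪ A : Finset 𝔼) : Set 𝔼) := by
    rw [h.left, h.right, convexHull_convexHull_union_left, convexHull_convexHull_union_right,
      Finset.coe_union]
  have hcP : IsCompact P := h.left ▸ V.finite_toSet.isCompact_convexHull ℝ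
  have hcR : IsCompact R := h.right ▸ A.finite_toSet.isCompact_convexHull ℝ
  have hpol : polarBody (convexHull ℝ (P ∪ R)) = P ∩ R := by
    have : polarBody (P ∪ R) = polarBody P ∩ polarBody R := by
      ext y
      simp [polarBody, or_imp, forall_and]
    rw [polarBody_convexHull, this, h.polar_left, h.polar_right, Set.inter_comm]
  refine ⟨hfin.toFinset, ⟨hQ, ?_, hpol, ?_⟩, fun x hx => ?_⟩
  · rw [hfin.coe_toFinset]
    exact eq_convexHull_of_extremePoints_subset (hcP.inter hcR)
      (h.convex_left.inter h.symm.convex_left) hfin extremePoints_subset subset_rfl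
  · rw [← hpol]
    refine polarBody_polarBody (convex_convexHull ℝ _) ?_
      (subset_convexHull ℝ _ (Or.inl h.zero_mem))
    rw [hQ]
    exact (V ∪ A).finite_toSet.isClosed_convexHull ℝ
  · exact h.exists_tangentAt_of_mem_extremePoints (hfin.mem_toFinset.1 hx)

end TangentPair

/-- A point of a face that lies in no smaller face is a relative interior point. -/
theorem PolarPair.mem_intrinsicInterior {P R : Set 𝔼} {V A : Finset 𝔼} (h : PolarPair P R V A)
    {F : Set 𝔼} (hF : IsExposed ℝ P F) {f : 𝔼} (hf : f ∈ F)
    (hfr : ∀ y ∈ R, ⟪y, f⟫ = 1 → y ∈ dualFace P F) : f ∈ intrinsicInterior ℝ F := by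
  classical
  refine _root_.mem_intrinsicInterior.2 ⟨⟨f, subset_affineSpan ℝ F hf⟩, ?_, rfl⟩
  let U : Set (affineSpan ℝ F) :=
    ⋂ a ∈ A.filter fun a => a ∉ dualFace P F, {z | ⟪a, (z : 𝔼)⟫ < 1}
  have hU : IsOpen U := isOpen_biInter_finset fun a _ =>
    isOpen_lt (by fun_prop) continuous_const
  refine mem_interior.2 ⟨U, fun z hz => ?_, hU, ?_⟩
  · have hz1 : ∀ y ∈ dualFace P F, ⟪y, (z : 𝔼)⟫ = 1 := fun y hy => by
      have h1 : (z : 𝔼) -ᵥ f ∈ vectorSpan ℝ F := by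
        rw [← direction_affineSpan]
        exact AffineSubspace.vsub_mem_direction z.2 (subset_affineSpan ℝ F hf)
      have h2 := (h.mem_vectorSpan_iff hF ⟨f, hf⟩).1 h1 y hy
      rw [vsub_eq_sub, inner_sub_right, inner_eq_one hf hy] at h2
      linarith
    refine (h.mem_face_iff hF).2 ⟨h.mem_left_iff.2 fun a ha => ?_, hz1⟩
    by_cases haF : a ∈ dualFace P F
    · exact (hz1 a haF).le
    · exact (Set.mem_iInter₂.1 hz a (Finset.mem_filter.2 ⟨ha, haF⟩)).le
  · refine Set.mem_iInter₂.2 fun a ha => ?_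
    obtain ⟨ha, haF⟩ := Finset.mem_filter.1 ha
    have haR := h.symm.subset_left ha
    exact lt_of_le_of_ne (h.inner_le_one haR (hF.subset hf)) fun h1 => haF (hfr a haR h1)

end Tangent

/-! ### The facets and the face lattice of `Q` -/

section Hull

variable {d : ℕ}

local notation "𝔼" => EuclideanSpace ℝ (Fin d)

/-- A pair of polar polytopes `P`, `R` such that the `t`-faces of `P` are tangent to the unit
sphere, together with the facet description of `Q = conv (P ∪ R)`. -/
structure HullPair (t : ℕ) (P R Q : Set (EuclideanSpace ℝ (Fin d)))
    (V A W X : Finset (EuclideanSpace ℝ (Fin d))) : Prop extends TangentPair t P R V A where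
  hull : PolarPair Q (P ∩ R) W X
  subset_union : ∀ w ∈ W, w ∈ P ∪ R
  tangentAt : ∀ x ∈ X, ∃ F, IsExposed ℝ P F ∧ faceRank F = t + 1 ∧ TangentAt F x

namespace HullPair

variable {t : ℕ} {P R Q : Set (EuclideanSpace ℝ (Fin d))}
  {V A W X : Finset (EuclideanSpace ℝ (Fin d))}

theorem left_subset (h : HullPair t P R Q V A W X) : P ⊆ Q := fun _ hx =>
  h.hull.mem_left_of_forall fun _ hy => h.inner_le_one hy.2 hx

theorem right_subset (h : HullPair t P R Q V A W X) : R ⊆ Q := fun _ hx =>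
  h.hull.mem_left_of_forall fun _ hy => h.symm.inner_le_one hy.1 hx

theorem mem_inter (h : HullPair t P R Q V A W X) {F : Set 𝔼} (hF : IsExposed ℝ P F)
    (hFt : faceRank F = t + 1) {x : 𝔼} (hx : TangentAt F x) : x ∈ P ∩ R :=
  ⟨hF.subset hx.1, h.symm.dualFace_subset F (h.mem_dualFace hF hFt hx)⟩

theorem face_eq_convexHull (h : HullPair t P R Q V A W X) {G : Set 𝔼} (hG : IsExposed ℝ Q G) :
    G = convexHull ℝ ((G ∩ P) ∪ (G ∩ R)) := by
  have h1 := h.hull.dualFace_eq_convexHull (h.hull.symm.dualFace_subset G)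
  rw [h.hull.dualFace_dualFace hG] at h1
  have hconv : Convex ℝ G := by
    rw [h1]; exact convex_convexHull ℝ _
  refine Set.Subset.antisymm ?_ (convexHull_min
    (Set.union_subset Set.inter_subset_left Set.inter_subset_left) hconv)
  conv_lhs => rw [h1]
  refine convexHull_mono ?_
  intro w hw
  exact (h.subset_union w hw.1).imp (fun hP => ⟨hw.2, hP⟩) fun hR => ⟨hw.2, hR⟩

/-- The hull of a tangent face and its dual face is cut out by the tangent hyperplane. -/
theorem convexHull_union_dualFace (h : HullPair t P R Q V A W X) {F : Set 𝔼}
    (hF : IsExposed ℝ P F) (hFt : faceRank F = t + 1) {x : 𝔼} (hx : TangentAt F x) :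
    convexHull ℝ (F ∪ dualFace P F) = dualFace (P ∩ R) {x} := by
  have hxs : {x} ⊆ P ∩ R := Set.singleton_subset_iff.2 (h.mem_inter hF hFt hx)
  have hmem : ∀ {y}, y ∈ dualFace (P ∩ R) {x} ↔ y ∈ Q ∧ ⟪x, y⟫ = 1 := by
    intro y
    simp [h.hull.mem_dualFace_iff]
  rw [h.face_eq_convexHull (h.hull.isExposed_dualFace hxs)]
  congr 2
  · ext p
    rw [Set.mem_inter_iff, hmem]
    refine ⟨fun hp => ⟨⟨h.left_subset (hF.subset hp), hx.2.2 p hp⟩, hF.subset hp⟩, fun hp => ?_⟩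
    exact (h.inner_eq_one_iff_mem_face hF hFt hx hp.2).1 hp.1.2
  · ext y
    rw [Set.mem_inter_iff, hmem]
    refine ⟨fun hy => ?_, fun hy => (h.inner_eq_one_iff_mem_dualFace hF hFt hx hy.2).1 hy.1.2⟩
    have hyR := h.symm.dualFace_subset F hy
    exact ⟨⟨h.right_subset hyR, hy.2 x hx.1⟩, hyR⟩

theorem isExposed_convexHull (h : HullPair t P R Q V A W X) {F : Set 𝔼}
    (hF : IsExposed ℝ P F) (hFt : faceRank F = t + 1) :
    IsExposed ℝ Q (convexHull ℝ (F ∪ dualFace P F)) := by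
  obtain ⟨x, hx⟩ := h.tangent F hF hFt
  rw [h.convexHull_union_dualFace hF hFt hx]
  exact h.hull.isExposed_dualFace (Set.singleton_subset_iff.2 (h.mem_inter hF hFt hx))

theorem mem_convexHull_iff (h : HullPair t P R Q V A W X) {F : Set 𝔼}
    (hF : IsExposed ℝ P F) (hFt : faceRank F = t + 1) {x : 𝔼} (hx : TangentAt F x) {y : 𝔼} :
    y ∈ convexHull ℝ (F ∪ dualFace P F) ↔ y ∈ Q ∧ ⟪x, y⟫ = 1 := by
  rw [h.convexHull_union_dualFace hF hFt hx]
  simp [h.hull.mem_dualFace_iff]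

theorem convexHull_inter_left (h : HullPair t P R Q V A W X) {F : Set 𝔼}
    (hF : IsExposed ℝ P F) (hFt : faceRank F = t + 1) :
    convexHull ℝ (F ∪ dualFace P F) ∩ P = F := by
  obtain ⟨x, hx⟩ := h.tangent F hF hFt
  ext p
  rw [Set.mem_inter_iff, h.mem_convexHull_iff hF hFt hx]
  refine ⟨fun hp => (h.inner_eq_one_iff_mem_face hF hFt hx hp.2).1 hp.1.2, fun hp => ?_⟩
  exact ⟨⟨h.left_subset (hF.subset hp), hx.2.2 p hp⟩, hF.subset hp⟩

theorem convexHull_inter_right (h : HullPair t P R Q V A W X) {F : Set 𝔼}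
    (hF : IsExposed ℝ P F) (hFt : faceRank F = t + 1) :
    convexHull ℝ (F ∪ dualFace P F) ∩ R = dualFace P F := by
  obtain ⟨x, hx⟩ := h.tangent F hF hFt
  ext y
  rw [Set.mem_inter_iff, h.mem_convexHull_iff hF hFt hx]
  refine ⟨fun hy => (h.inner_eq_one_iff_mem_dualFace hF hFt hx hy.2).1 hy.1.2, fun hy => ?_⟩
  have hyR := h.symm.dualFace_subset F hy
  exact ⟨⟨h.right_subset hyR, hy.2 x hx.1⟩, hyR⟩

theorem subset_convexHull_iff (h : HullPair t P R Q V A W X) {F : Set 𝔼}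
    (hF : IsExposed ℝ P F) (hFt : faceRank F = t + 1) {G : Set 𝔼} (hG : IsExposed ℝ Q G) :
    G ⊆ convexHull ℝ (F ∪ dualFace P F) ↔ G ∩ P ⊆ F ∧ G ∩ R ⊆ dualFace P F := by
  constructor
  · intro hs
    refine ⟨?_, ?_⟩
    · conv_rhs => rw [← h.convexHull_inter_left hF hFt]
      exact Set.inter_subset_inter_left _ hs
    · conv_rhs => rw [← h.convexHull_inter_right hF hFt]
      exact Set.inter_subset_inter_left _ hs
  · rintro ⟨h1, h2⟩
    rw [h.face_eq_convexHull hG]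
    exact convexHull_mono (Set.union_subset_union h1 h2)

/-- The dual of a facet through the tangent point is that point. -/
theorem dualFace_subset_singleton {F G : Set 𝔼} (h : HullPair t P R Q V A W X) {x : 𝔼}
    (hx : TangentAt F x) (hxG : x ∈ G) : dualFace Q G ⊆ {x} := fun z hz => by
  have hzPR := h.hull.symm.dualFace_subset G hz
  exact eq_of_inner_eq_one hx.2.1 (h.inner_le_one hzPR.2 hzPR.1) (hz.2 x hxG)

/-- The dual face in `P ∩ R` is the single tangent point, of rank one, and dual ranks add up to `d +
1`. -/
theorem faceRank_convexHull (h : HullPair t P R Q V A W X) {F : Set 𝔼}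
    (hF : IsExposed ℝ P F) (hFt : faceRank F = t + 1) :
    faceRank (convexHull ℝ (F ∪ dualFace P F)) = d := by
  obtain ⟨x, hx⟩ := h.tangent F hF hFt
  have hG := h.isExposed_convexHull hF hFt
  have hxG : x ∈ convexHull ℝ (F ∪ dualFace P F) := subset_convexHull ℝ _ (Or.inl hx.1)
  have hd : dualFace Q (convexHull ℝ (F ∪ dualFace P F)) = {x} := by
    refine Set.Subset.antisymm (h.dualFace_subset_singleton hx hxG) ?_
    rw [h.convexHull_union_dualFace hF hFt hx]
    exact h.hull.symm.subset_dualFace_dualFace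
      (Set.singleton_subset_iff.2 (h.mem_inter hF hFt hx))
  have hs := h.hull.faceRank_add_faceRank_dualFace hG
  rw [hd, faceRank_of_nonempty (Set.singleton_nonempty x), vectorSpan_singleton,
    finrank_bot] at hs
  omega

theorem eq_convexHull_of_mem (h : HullPair t P R Q V A W X) {F : Set 𝔼}
    (hF : IsExposed ℝ P F) (hFt : faceRank F = t + 1) {x : 𝔼} (hx : TangentAt F x) {G : Set 𝔼}
    (hG : IsExposed ℝ Q G) (hs : G ⊆ convexHull ℝ (F ∪ dualFace P F)) (hxG : x ∈ G) :
    G = convexHull ℝ (F ∪ dualFace P F) := by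
  refine hs.antisymm ?_
  rw [h.convexHull_union_dualFace hF hFt hx]
  conv_rhs => rw [← h.hull.dualFace_dualFace hG]
  exact PolarPair.dualFace_anti _ (h.dualFace_subset_singleton hx hxG)

/-- A face of `Q` is the intersection of the facets `conv (F ∪ F°)` that contain it. -/
theorem exists_subset_convexHull_not_mem (h : HullPair t P R Q V A W X) {G : Set 𝔼}
    (hG : IsExposed ℝ Q G) {y : 𝔼} (hy : y ∈ Q) (hyG : y ∉ G) :
    ∃ F, IsExposed ℝ P F ∧ faceRank F = t + 1 ∧ G ⊆ convexHull ℝ (F ∪ dualFace P F) ∧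
      y ∉ convexHull ℝ (F ∪ dualFace P F) := by
  obtain ⟨x, hxX, hxG, hxy⟩ := h.hull.exists_filter_inner_lt_one hG hy hyG
  obtain ⟨F, hF, hFt, hx⟩ := h.tangentAt x hxX
  refine ⟨F, hF, hFt, fun z hz => ?_, fun hc => hxy.ne ((h.mem_convexHull_iff hF hFt hx).1 hc).2⟩
  exact (h.mem_convexHull_iff hF hFt hx).2 ⟨hG.subset hz, PolarPair.inner_eq_one hz hxG⟩

/-- Intersecting with `P` recovers `F`. A face of dimension `d - 1` lies in some `conv (F ∪ F°)` and
equals it by rank. -/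
theorem bijOn_facets (h : HullPair t P R Q V A W X) :
    Set.BijOn (fun F => convexHull ℝ (F ∪ dualFace P F)) (facesOfDim P t)
      (facesOfDim Q (d - 1)) := by
  have hd : d - 1 + 1 = d := Nat.sub_add_cancel (by have := h.lt_dim; omega)
  refine ⟨fun F hF => ?_, fun F hF K hK hFK => ?_, fun G hG => ?_⟩
  · rw [mem_facesOfDim_iff] at hF ⊢
    rw [hd]
    exact ⟨h.isExposed_convexHull hF.1 hF.2, h.faceRank_convexHull hF.1 hF.2⟩
  · rw [mem_facesOfDim_iff] at hF hK
    rw [← h.convexHull_inter_left hF.1 hF.2, ← h.convexHull_inter_left hK.1 hK.2]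
    exact congrArg (· ∩ P) hFK
  · rw [mem_facesOfDim_iff, hd] at hG
    have hQ := h.hull.faceRank_left
    have hGQ : G ⊂ Q := lt_of_le_of_ne hG.1.subset fun he => by rw [he] at hG; omega
    obtain ⟨y, hy, hyG⟩ := Set.exists_of_ssubset hGQ
    obtain ⟨F, hF, hFt, hGF, -⟩ := h.exists_subset_convexHull_not_mem hG.1 hy hyG
    refine ⟨F, mem_facesOfDim_iff.2 ⟨hF, hFt⟩, ?_⟩
    by_contra hne
    have := h.hull.faceRank_lt hG.1 (h.isExposed_convexHull hF hFt)
      (lt_of_le_of_ne hGF (Ne.symm hne))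
    rw [h.faceRank_convexHull hF hFt] at this
    omega

theorem isOrthogonalSum (h : HullPair t P R Q V A W X) {F : Set 𝔼} (hF : IsExposed ℝ P F)
    (hFt : faceRank F = t + 1) :
    IsOrthogonalSum (convexHull ℝ (F ∪ dualFace P F)) F (dualFace P F) := by
  obtain ⟨x, hx⟩ := h.tangent F hF hFt
  have hxd := h.mem_dualFace hF hFt hx
  refine ⟨rfl, x, h.mem_intrinsicInterior hF hx.1 fun y hy hyx => ?_,
    h.symm.mem_intrinsicInterior (h.isExposed_dualFace_left hF) hxd fun y hy hyx => ?_,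
    fun a ha b hb => ?_⟩
  · rw [real_inner_comm] at hyx
    exact (h.inner_eq_one_iff_mem_dualFace hF hFt hx hy).1 hyx
  · rw [h.dualFace_dualFace hF]
    rw [real_inner_comm] at hyx
    exact (h.inner_eq_one_iff_mem_face hF hFt hx hy).1 hyx
  · rw [inner_sub_left, inner_sub_right, inner_sub_right, hb.2 a ha, hb.2 x hx.1, hx.inner_self,
      real_inner_comm, hx.2.2 a ha]
    norm_num

theorem isPolytopeOfDim (h : HullPair t P R Q V A W X) : IsPolytopeOfDim d Q :=
  ⟨⟨W, W.finite_toSet, h.hull.left⟩, hasAffineDim_iff.2 h.hull.faceRank_left⟩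

/-- The faces `H` of `P` such that `G ⊆ conv (H ∪ H°)`. -/
def supportingFaces (P R G : Set (EuclideanSpace ℝ (Fin d))) : Set (FaceLattice P) :=
  {H | G ∩ P ⊆ H.1 ∧ G ∩ R ⊆ dualFace P H.1}

theorem mem_rankLevel_iff (h : HullPair t P R Q V A W X) {F : FaceLattice P} :
    F ∈ rankLevel (FaceLattice P) t ↔ faceRank F.1 = t + 1 := by
  change Order.height F = ((t + 1 : ℕ) : ℕ∞) ↔ _
  rw [h.height_eq_faceRank F]
  exact Nat.cast_inj

theorem supportingFaces_self (h : HullPair t P R Q V A W X) : supportingFaces P R Q = ∅ := by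
  refine Set.eq_empty_of_forall_notMem fun H hH => ?_
  have h1 : H.1 = P := H.2.subset.antisymm fun p hp => hH.1 ⟨h.left_subset hp, hp⟩
  have h2 := hH.2 ⟨h.right_subset h.symm.zero_mem, h.symm.zero_mem⟩
  rw [h1, h.dualFace_self] at h2
  exact h2

theorem supportingFaces_convexHull (h : HullPair t P R Q V A W X) {F : FaceLattice P}
    (hFt : faceRank F.1 = t + 1) :
    supportingFaces P R (convexHull ℝ (F.1 ∪ dualFace P F.1)) = {F} := by
  ext H
  rw [supportingFaces, Set.mem_ofPred_eq, h.convexHull_inter_left F.2 hFt,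
    h.convexHull_inter_right F.2 hFt, h.dualFace_subset_dualFace_iff F.2 H.2,
    Set.mem_singleton_iff]
  exact ⟨fun hH => Subtype.ext (hH.2.antisymm hH.1), fun hH => hH ▸ ⟨subset_rfl, subset_rfl⟩⟩

theorem inter_left_eq_dualFace (h : HullPair t P R Q V A W X) {T : Set 𝔼} :
    dualFace (P ∩ R) T ∩ P = dualFace R T := by
  ext p
  rw [Set.mem_inter_iff, h.hull.mem_dualFace_iff, h.mem_dualFace_iff]
  exact ⟨fun hp => ⟨hp.2, hp.1.2⟩, fun hp => ⟨⟨h.left_subset hp.1, hp.2⟩, hp.1⟩⟩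

theorem inter_right_eq_dualFace (h : HullPair t P R Q V A W X) {T : Set 𝔼} :
    dualFace (P ∩ R) T ∩ R = dualFace P T := by
  ext p
  rw [Set.mem_inter_iff, h.hull.mem_dualFace_iff, h.symm.mem_dualFace_iff]
  exact ⟨fun hp => ⟨hp.2, hp.1.2⟩, fun hp => ⟨⟨h.right_subset hp.1, hp.2⟩, hp.1⟩⟩

/-- A proper face `G` lies in the facet of some `F`. If it contains the tangent point of `F` it is
that facet; otherwise the tangent point witnesses that `F` is strictly between `G ∩ P` and the dual
of `G ∩ R`. -/
theorem supportingFaces_mem_etSets (h : HullPair t P R Q V A W X) {G : Set 𝔼}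
    (hG : IsExposed ℝ Q G) : supportingFaces P R G ∈ etSets (FaceLattice P) t := by
  rcases eq_or_ne G Q with rfl | hne
  · exact Or.inl h.supportingFaces_self
  obtain ⟨y, hy, hyG⟩ := Set.exists_of_ssubset (lt_of_le_of_ne hG.subset hne)
  obtain ⟨F, hF, hFt, hGF, -⟩ := h.exists_subset_convexHull_not_mem hG hy hyG
  obtain ⟨x, hx⟩ := h.tangent F hF hFt
  have hT := h.hull.symm.dualFace_subset G
  have hGT := h.hull.dualFace_dualFace hG
  have hGP : IsExposed ℝ P (G ∩ P) := by
    conv in G ∩ P => rw [← hGT]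
    rw [h.inter_left_eq_dualFace]
    exact h.isExposed_dualFace (hT.trans Set.inter_subset_right)
  have hGR : IsExposed ℝ R (G ∩ R) := by
    conv in G ∩ R => rw [← hGT]
    rw [h.inter_right_eq_dualFace]
    exact h.symm.isExposed_dualFace (hT.trans Set.inter_subset_left)
  have hz := h.symm.isExposed_dualFace_left hGR
  obtain ⟨h1, h2⟩ := (h.subset_convexHull_iff hF hFt hG).1 hGF
  have h2' : F ⊆ dualFace R (G ∩ R) := by
    rw [← h.dualFace_dualFace hF]
    exact PolarPair.dualFace_anti R h2
  by_cases hxG : x ∈ G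
  · rw [h.eq_convexHull_of_mem hF hFt hx hG hGF hxG]
    exact Or.inr (Or.inl ⟨⟨F, hF⟩, h.mem_rankLevel_iff.2 hFt,
      h.supportingFaces_convexHull (F := ⟨F, hF⟩) hFt⟩)
  · refine Or.inr (Or.inr ⟨⟨G ∩ P, hGP⟩, ⟨dualFace R (G ∩ R), hz⟩,
      ⟨⟨F, hF⟩, h.mem_rankLevel_iff.2 hFt, ?_, ?_⟩, ?_⟩)
    · exact lt_iff_le_not_ge.2 ⟨h1, fun hc => hxG ((show F ⊆ G ∩ P from hc) hx.1).1⟩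
    · refine lt_iff_le_not_ge.2 ⟨h2', fun hc => hxG ?_⟩
      have := PolarPair.dualFace_anti P (show dualFace R (G ∩ R) ⊆ F from hc) (h.mem_dualFace hF hFt hx)
      rw [h.symm.dualFace_dualFace hGR] at this
      exact this.1
    · ext H
      refine and_congr_right fun _ => ?_
      have := h.dualFace_subset_dualFace_iff hz H.2
      rw [h.symm.dualFace_dualFace hGR] at this
      exact this

theorem supportingFaces_subset_iff (h : HullPair t P R Q V A W X) {G K : Set 𝔼}
    (hG : IsExposed ℝ Q G) (hK : IsExposed ℝ Q K) :
    supportingFaces P R K ⊆ supportingFaces P R G ↔ G ⊆ K := by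
  refine ⟨fun hs y hy => by_contra fun hyK => ?_, fun hs H hH =>
    ⟨(Set.inter_subset_inter_left _ hs).trans hH.1, (Set.inter_subset_inter_left _ hs).trans hH.2⟩⟩
  obtain ⟨F, hF, hFt, hKF, hyF⟩ := h.exists_subset_convexHull_not_mem hK (hG.subset hy) hyK
  have hmem : (⟨F, hF⟩ : FaceLattice P) ∈ supportingFaces P R K :=
    (h.subset_convexHull_iff hF hFt hK).1 hKF
  exact hyF ((h.subset_convexHull_iff hF hFt hG).2 (hs hmem) hy)

/-- The required `G` is the intersection of the facets belonging to the `t`-faces between `x` and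
`z`. It meets `P` in `x` and `R` in the dual of `z`. -/
theorem exists_supportingFaces_eq_Icc (h : HullPair t P R Q V A W X) {x y z : FaceLattice P}
    (hy : faceRank y.1 = t + 1) (hxy : x < y) (hyz : y < z) :
    ∃ G, IsExposed ℝ Q G ∧ supportingFaces P R G = Set.Icc x z := by
  let T : Set 𝔼 := {c | ∃ F, IsExposed ℝ P F ∧ faceRank F = t + 1 ∧ x.1 ⊆ F ∧ F ⊆ z.1 ∧
    TangentAt F c}
  have hT : T ⊆ P ∩ R := fun c ⟨F, hF, hFt, _, _, hc⟩ => h.mem_inter hF hFt hc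
  have hxy' : x.1 ⊂ y.1 := hxy
  have hyz' : y.1 ⊂ z.1 := hyz
  have hrx := h.faceRank_lt x.2 y.2 hxy'
  have hrz := h.faceRank_lt y.2 z.2 hyz'
  have hP : dualFace R T = x.1 := by
    refine Set.Subset.antisymm (fun p hp => by_contra fun hpx => ?_) fun p hp =>
      h.mem_dualFace_iff.2 ⟨x.2.subset hp, fun c ⟨F, hF, hFt, hxF, _, hc⟩ => hc.2.2 p (hxF hp)⟩
    obtain ⟨F, hF, hxF, hFz, hFt, hpF⟩ := h.exists_face_of_rank_not_mem x.2 z.2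
      (hxy'.trans hyz') (hy ▸ hrx) (hy ▸ hrz) hpx
    obtain ⟨c, hc⟩ := h.tangent F hF hFt
    have hp' := h.mem_dualFace_iff.1 hp
    exact hpF ((h.inner_eq_one_iff_mem_face hF hFt hc hp'.1).1
      (hp'.2 c ⟨F, hF, hFt, hxF.1, hFz.1, hc⟩))
  have hR : dualFace P T = dualFace P z.1 := by
    refine Set.Subset.antisymm (fun q hq => by_contra fun hqz => ?_) fun q hq =>
      h.symm.mem_dualFace_iff.2 ⟨h.symm.dualFace_subset _ hq,
        fun c ⟨F, hF, hFt, _, hFz, hc⟩ => hq.2 c (hFz hc.1)⟩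
    have hsx := h.faceRank_add_faceRank_dualFace x.2
    have hsz := h.faceRank_add_faceRank_dualFace z.2
    -- The same argument in `R`: duals of `t`-faces have rank `d + 1 - (t + 1) = d - t`.
    obtain ⟨K, hK, hzK, hKx, hKt, hqK⟩ := h.symm.exists_face_of_rank_not_mem
      (h.isExposed_dualFace_left z.2) (h.isExposed_dualFace_left x.2)
      ((h.dualFace_ssubset_dualFace_iff z.2 x.2).2 (hxy'.trans hyz')) (k := d - t)
      (by omega) (by omega) hqz
    have hF := h.symm.isExposed_dualFace_left hK
    have hFK := h.symm.dualFace_dualFace hK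
    have hsK := h.symm.faceRank_add_faceRank_dualFace hK
    have htd := h.lt_dim
    have hFt : faceRank (dualFace R K) = t + 1 := by omega
    obtain ⟨c, hc⟩ := h.tangent _ hF hFt
    have hq' := h.symm.mem_dualFace_iff.1 hq
    refine hqK ?_
    rw [← hFK]
    refine (h.inner_eq_one_iff_mem_dualFace hF hFt hc hq'.1).1
      (hq'.2 c ⟨_, hF, hFt, ?_, ?_, hc⟩)
    · rw [← h.dualFace_dualFace x.2]
      exact PolarPair.dualFace_anti R hKx.1
    · conv_rhs => rw [← h.dualFace_dualFace z.2]
      exact PolarPair.dualFace_anti R hzK.1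
  refine ⟨dualFace (P ∩ R) T, h.hull.isExposed_dualFace hT, ?_⟩
  ext H
  rw [supportingFaces, Set.mem_ofPred_eq, h.inter_left_eq_dualFace,
    h.inter_right_eq_dualFace, hP, hR, h.dualFace_subset_dualFace_iff z.2 H.2]
  rfl

theorem nonempty_orderIso (h : HullPair t P R Q V A W X) :
    Nonempty (FaceLattice Q ≃o EtConstruction (FaceLattice P) t) := by
  let Φ : FaceLattice Q → EtConstruction (FaceLattice P) t := fun G =>
    OrderDual.toDual ⟨supportingFaces P R G.1, h.supportingFaces_mem_etSets G.2⟩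
  have hΦ : ∀ G K, Φ G ≤ Φ K ↔ G ≤ K := fun G K => h.supportingFaces_subset_iff G.2 K.2
  refine ⟨RelIso.ofSurjective (OrderEmbedding.ofMapLEIff Φ hΦ) fun s => ?_⟩
  suffices ∃ G, IsExposed ℝ Q G ∧ supportingFaces P R G = (OrderDual.ofDual s).1 by
    obtain ⟨G, hG, hs⟩ := this
    exact ⟨⟨G, hG⟩, congrArg OrderDual.toDual (Subtype.ext hs)⟩
  obtain hs | ⟨y, hy, hs⟩ | ⟨x, z, ⟨y, hy, hxy, hyz⟩, hs⟩ := (OrderDual.ofDual s).2 <;> rw [hs]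
  · exact ⟨Q, IsExposed.refl Q, h.supportingFaces_self⟩
  · have hyt := h.mem_rankLevel_iff.1 hy
    exact ⟨_, h.isExposed_convexHull y.2 hyt, h.supportingFaces_convexHull hyt⟩
  · exact h.exists_supportingFaces_eq_Icc (h.mem_rankLevel_iff.1 hy) hxy hyz

end HullPair

end Hull

theorem mainTheorem8 (d t : ℕ) (ht : 1 ≤ t) (htd : t + 2 ≤ d)
    (P : Set (EuclideanSpace ℝ (Fin d)))
    (hP : IsPolytopeOfDim d P)
    (h0 : (0 : EuclideanSpace ℝ (Fin d)) ∈ interior P)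
    (htan : ∀ F ∈ facesOfDim P t, IsTangentToUnitSphere F) :
    IsPolytopeOfDim d (convexHull ℝ (P ∪ polarBody P)) ∧
    Nonempty (FaceLattice (convexHull ℝ (P ∪ polarBody P)) ≃o EtConstruction (FaceLattice P) t) ∧
    Set.BijOn (fun F => convexHull ℝ (F ∪ dualFace P F)) (facesOfDim P t)
      (facesOfDim (convexHull ℝ (P ∪ polarBody P)) (d - 1)) ∧
    ∀ F ∈ facesOfDim P t, IsOrthogonalSum (convexHull ℝ (F ∪ dualFace P F)) F (dualFace P F) := by
  classical
  obtain ⟨V, A, hVA⟩ := exists_polarPair hP.1 h0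
  have hT : TangentPair t P (polarBody P) V A := ⟨hVA, by omega, fun F hF hFt =>
    isTangentToUnitSphere_iff.1 (htan F (mem_facesOfDim_iff.2 ⟨hF, hFt⟩))⟩
  obtain ⟨X, hX, hXt⟩ := hT.exists_polarPair_hull
  have h : HullPair t P (polarBody P) _ V A (V ∪ A) X := ⟨hT, hX, fun w hw =>
    (Finset.mem_union.1 hw).imp hVA.subset_left hVA.symm.subset_left, hXt⟩
  refine ⟨h.isPolytopeOfDim, h.nonempty_orderIso, h.bijOn_facets, fun F hF => ?_⟩
  rw [mem_facesOfDim_iff] at hF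
  exact h.isOrthogonalSum hF.1 hF.2
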